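/- Let $(\Omega,\mathcal F,(\mathcal F_t)_{t\ge 0},\mathbb P)$ be a filtered probability space, let $\alpha^+,\lambda^+,\alpha^-,\lambda^->0$ be arbitrary, and let $X\sim\Gamma(\alpha^+,\lambda^+;\alpha^-,\lambda^-)$ be a bilateral Gamma process under $\mathbb P$, i.e. a càdlàg Lévy process with respect to $(\mathcal F_t)$ such that $X_1$ is distributed as $Y-Z$ with $Y,Z$ independent, $Y\sim\Gamma(\alpha^+,\lambda^+)$ and $Z\sim\Gamma(\alpha^-,\lambda^-)$ (shape, rate). Let $X^+$ and $X^-$ be the positive and the negative variation processes of $X$ (the sums of the upward and of the absolute values of the downward jumps). Then $X=X^+-X^-$ almost surely, and $X^+\sim\Gamma(\alpha^+,\lambda^+)$, $X^-\sim\Gamma(\alpha^-,\lambda^-)$ are independent Gamma processes. Put $\Psi^\pm(\theta)=\ln\mathbb E[e^{\theta X_1^\pm}]$ for $\theta<\lambda^\pm$. For $\theta^+<\lambda^+$ and $\theta^-<\lambda^-$ the bilateral Esscher transform $\mathbb P^{(\theta^+,\theta^-)}$ is given on each $\mathcal F_t$, $t\ge 0$, by $$\frac{d\mathbb P^{(\theta^+,\theta^-)}}{d\mathbb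 P}\Big|_{\mathcal F_t}=e^{\theta^+X_t^+-\Psi^+(\theta^+)t}\,e^{\theta^-X_t^--\Psi^-(\theta^-)t};$$ this defines a consistent family of probability measures on the $\mathcal F_t$, each equivalent to the restriction of $\mathbb P$. Let $r\ge q\ge 0$ and $S_0>0$, and let $\mathcal M_{\mathbb P}$ be the set of all $(\theta^+,\theta^-)\in(-\infty,\lambda^+)\times(-\infty,\lambda^-)$ such that $\mathbb P^{(\theta^+,\theta^-)}$ is a martingale measure, i.e. such that the discounted stock price $\tilde S_t=S_0e^{X_t-(r-q)t}$ is a local martingale under it. Let $\mathbb H(\mathbb Q\,|\,\mathbb P)=\mathbb E[\Lambda_1\ln\Lambda_1]$ with $\Lambda_1=\frac{d\mathbb Q}{d\mathbb P}|_{\mathcal F_1}$ denote the relative entropy. Let $I=\big(\lambda^+-(1-e^{-(r-q)/\alpha^+})^{-1},\,\lambda^+-1\big)$, where the left end point is read as $-\infty$ if $r=q$, and for $\theta\in I$ let $$\Phi(\theta)=\lambda^--\left(\left(\Big(\frac{\lambda^+-\theta}{\lambda^+-\theta-1}\Big)^{\alpha^+}e^{-(r-q)}\right)^{1/\alpha^-}-1\right)^{-1},$$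 $$f(\theta)=\alpha^+g\Big(\frac{\lambda^+}{\lambda^+-\theta}\Big)+\alpha^-g\Big(\frac{\lambda^-}{\lambda^--\Phi(\theta)}\Big),\qquad g(x)=x-1-\ln x.$$ Then there exists $(\theta^+,\theta^-)\in\mathcal M_{\mathbb P}$ such that $$\mathbb H(\mathbb P^{(\theta^+,\theta^-)}\,|\,\mathbb P)=\min_{(\vartheta^+,\vartheta^-)\in\mathcal M_{\mathbb P}}\mathbb H(\mathbb P^{(\vartheta^+,\vartheta^-)}\,|\,\mathbb P).$$ For every such $(\theta^+,\theta^-)$ we have $\theta^+\in I$ and $\theta^-=\Phi(\theta^+)$, the point $\theta^+$ minimizes $f$ on $I$, we have $X\sim\Gamma(\alpha^+,\lambda^+-\theta^+;\alpha^-,\lambda^--\theta^-)$ under $\mathbb P^{(\theta^+,\theta^-)}$, and the value of the minimal entropy is $\mathbb H(\mathbb P^{(\theta^+,\theta^-)}\,|\,\mathbb P)=f(\theta^+)$. If there is a probability measure on $\mathcal F$ whose restrictions to all $\mathcal F_t$ are those of $\mathbb P^{(\theta^+,\theta^-)}$, then the last two statements hold for it as well, and $\tilde S$ is a martingale under it.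 -/

import Mathlib

open MeasureTheory ProbabilityTheory Filter Topology
open scoped NNReal ENNReal

noncomputable section

namespace BilateralGamma

/-- The bilateral Gamma distribution `Γ(αp, ℓp; αm, ℓm)`: the law of `Y - Z` for independent
`Y ∼ Γ(αp, ℓp)` and `Z ∼ Γ(αm, ℓm)` (shape, rate). -/
def bilateralGammaMeasure (αp ℓp αm ℓm : ℝ) : Measure ℝ :=
  ((gammaMeasure αp ℓp).prod (gammaMeasure αm ℓm)).map (fun y => y.1 - y.2)

variable {Ω : Type*} {mΩ : MeasurableSpace Ω}

/-! Measures that are only prescribed locally along a filtration `𝓕` are described by a family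
`Q : ℝ≥0 → Measure Ω`, where only the values of `Q t` on `𝓕 t` matter. A measure `μ` on the whole
of `Ω` is the constant family `fun _ => μ`. -/

/-- `Q` is a locally prescribed probability measure that is locally equivalent to `P`: the
restrictions of `Q t` to `𝓕 t` are probability measures, they are consistent, and they are
equivalent to the restrictions of `P`. -/
structure IsLocallyEquivalentProbability (𝓕 : Filtration ℝ≥0 mΩ) (P : Measure Ω)
    (Q : ℝ≥0 → Measure Ω) : Prop where
  isProbabilityMeasure : ∀ t, IsProbabilityMeasure (Q t)
  consistent : ∀ s t, s ≤ t → (Q t).trim (𝓕.le s) = (Q s).trim (𝓕.le s)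
  absolutelyContinuous : ∀ t, (Q t).trim (𝓕.le t) ≪ P.trim (𝓕.le t)
  absolutelyContinuous' : ∀ t, P.trim (𝓕.le t) ≪ (Q t).trim (𝓕.le t)

/-- `X` is a real Lévy process with respect to the filtration `𝓕`, under the (possibly only
locally prescribed) measure `Q`. -/
structure IsLevyProcess (𝓕 : Filtration ℝ≥0 mΩ) (Q : ℝ≥0 → Measure Ω) (X : ℝ≥0 → Ω → ℝ) :
    Prop where
  adapted : Adapted 𝓕 X
  zero : ∀ᵐ ω ∂(Q 0), X 0 ω = 0
  right_continuous : ∀ ω t, ContinuousWithinAt (fun s => X s ω) (Set.Ici t) t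
  left_limits : ∀ ω t, ∃ l, Tendsto (fun s => X s ω) (𝓝[<] t) (𝓝 l)
  indep : ∀ s t, s ≤ t →
    Indep (𝓕 s) (MeasurableSpace.comap (fun ω => X t ω - X s ω) inferInstance) (Q t)
  stationary : ∀ s t, (Q (s + t)).map (fun ω => X (s + t) ω - X s ω) = (Q t).map (X t)

/-- `X ∼ Γ(αp, ℓp; αm, ℓm)` under `Q`: `X` is a Lévy process and `X 1` has a bilateral Gamma
distribution. -/
def IsBilateralGammaProcess (𝓕 : Filtration ℝ≥0 mΩ) (Q : ℝ≥0 → Measure Ω) (X : ℝ≥0 → Ω → ℝ)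
    (αp ℓp αm ℓm : ℝ) : Prop :=
  IsLevyProcess 𝓕 Q X ∧ (Q 1).map (X 1) = bilateralGammaMeasure αp ℓp αm ℓm

/-- The positive variation of the path `s ↦ x s` on `[0, t]`. -/
def positiveVariation (x : ℝ≥0 → ℝ) (t : ℝ≥0) : ℝ≥0∞ :=
  ⨆ p : ℕ × {u : ℕ → ℝ≥0 // Monotone u ∧ ∀ i, u i ≤ t},
    ∑ i ∈ Finset.range p.1, ENNReal.ofReal (x (p.2.1 (i + 1)) - x (p.2.1 i))

/-- The component `X⁺` in the decomposition `X = X⁺ - X⁻` of a process of finite variation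
started at `0` into its minimal nondecreasing parts. For a bilateral Gamma process, which moves
by jumps only, `X⁺ t` is the sum of the upward jumps until `t`. -/
def plusPart (X : ℝ≥0 → Ω → ℝ) (t : ℝ≥0) (ω : Ω) : ℝ :=
  (positiveVariation (fun s => X s ω) t).toReal

/-- The component `X⁻` in the decomposition `X = X⁺ - X⁻`. -/
def minusPart (X : ℝ≥0 → Ω → ℝ) (t : ℝ≥0) (ω : Ω) : ℝ :=
  (positiveVariation (fun s => -X s ω) t).toReal

/-- The likelihood process `exp (θp X⁺ t - Ψ⁺(θp) t) * exp (θm X⁻ t - Ψ⁻(θm) t)`, where `Ψ⁺`, `Ψ⁻`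
are the cumulant generating functions of `X⁺ 1`, `X⁻ 1`. -/
def esscherLikelihood (P : Measure Ω) (X : ℝ≥0 → Ω → ℝ) (θp θm : ℝ) (t : ℝ≥0) (ω : Ω) : ℝ :=
  Real.exp (θp * plusPart X t ω - cgf (plusPart X 1) P θp * t) *
    Real.exp (θm * minusPart X t ω - cgf (minusPart X 1) P θm * t)

/-- The bilateral Esscher transform: the locally prescribed measure that has the density
`esscherLikelihood P X θp θm t` with respect to `P` on `𝓕 t`. -/
def bilateralEsscher (P : Measure Ω) (X : ℝ≥0 → Ω → ℝ) (θp θm : ℝ) : ℝ≥0 → Measure Ω :=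
  fun t => P.withDensity (fun ω => ENNReal.ofReal (esscherLikelihood P X θp θm t ω))

/-- The discounted stock price `S₀ exp (X t - (r - q) t)`. -/
def discountedPrice (S₀ r q : ℝ) (X : ℝ≥0 → Ω → ℝ) (t : ℝ≥0) (ω : Ω) : ℝ :=
  S₀ * Real.exp (X t ω - (r - q) * t)

/-- `S` is a local martingale under the (possibly only locally prescribed) measure `Q`: on each
`[0, T]` it is a local martingale under `Q T`. -/
def IsLocalMartingale (𝓕 : Filtration ℝ≥0 mΩ) (Q : ℝ≥0 → Measure Ω) (S : ℝ≥0 → Ω → ℝ) : Prop :=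
  ∀ T, Locally (fun Y => Martingale Y 𝓕 (Q T)) 𝓕 (fun t => S (min t T)) (Q T)

/-- The set of parameters for which the bilateral Esscher transform is a martingale measure for
the discounted stock price. -/
def martingaleParameters (𝓕 : Filtration ℝ≥0 mΩ) (P : Measure Ω) (X : ℝ≥0 → Ω → ℝ)
    (S₀ r q ℓp ℓm : ℝ) : Set (ℝ × ℝ) :=
  {θ | θ.1 < ℓp ∧ θ.2 < ℓm ∧
    IsLocalMartingale 𝓕 (bilateralEsscher P X θ.1 θ.2) (discountedPrice S₀ r q X)}

/-- The relative entropy of `Q` with respect to `P` on `𝓕 1`, i.e. `𝔼[Λ₁ log Λ₁]` for the density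
`Λ₁` of `Q` with respect to `P` on `𝓕 1`. -/
def relativeEntropy (𝓕 : Filtration ℝ≥0 mΩ) (P : Measure Ω) (Q : ℝ≥0 → Measure Ω) : ℝ≥0∞ :=
  InformationTheory.klDiv ((Q 1).trim (𝓕.le 1)) (P.trim (𝓕.le 1))

/-- The interval `(ℓp - (1 - exp (-(r - q) / αp))⁻¹, ℓp - 1)`, where the left end point is `-∞` if
`r = q`. -/
def parameterInterval (r q αp ℓp : ℝ) : Set ℝ :=
  {θ | (q < r → ℓp - (1 - Real.exp (-(r - q) / αp))⁻¹ < θ) ∧ θ < ℓp - 1}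

/-- The function `Φ` on `parameterInterval r q αp ℓp`. -/
def Phi (r q αp ℓp αm ℓm θ : ℝ) : ℝ :=
  ℓm - ((((ℓp - θ) / (ℓp - θ - 1)) ^ αp * Real.exp (-(r - q))) ^ (1 / αm) - 1)⁻¹

/-- `g(x) = x - 1 - ln x`. -/
def gFun (x : ℝ) : ℝ := x - 1 - Real.log x

/-- The function `f` on `parameterInterval r q αp ℓp`. -/
def entropyFun (r q αp ℓp αm ℓm θ : ℝ) : ℝ :=
  αp * gFun (ℓp / (ℓp - θ)) + αm * gFun (ℓm / (ℓm - Phi r q αp ℓp αm ℓm θ))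

end BilateralGamma

end

/-! Everything rests on the joint law of `(X⁺, X⁻)`: given `𝓕 s`, its increment over `[s, t]` is a
pair of independent Gamma variables. No jump measure is needed. By right continuity the positive and
negative variations over `[s, t]` are limits of sums of positive and negative parts of increments
along equidistant partitions. With `n` steps the joint characteristic function is the `n`-th power
of a one-step quantity. One step is `Y - Z` with Gamma shapes of order `1/n`; its parts differ from
`Y` and `Z` by `min Y Z ≤ √Y √Z`, whose mean is `O(n⁻²)`. Hence the power converges to the product
of two Gamma characteristic functions (`tendsto_integral_bilateralGammaMeasure_pow`,
`IsBilateralGammaProcess.measure_inter_partIncrement`).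

The Esscher density at `t` is the density at `s` times an exponential function of this increment,
and tilting a Gamma law by `e^{θx}` only lowers its rate by `θ`. This gives consistency, the law of
`X` under the transform and, since the log-density is affine in `X⁺ 1` and `X⁻ 1`, the entropy
(`IsAdmissible.bilateralEsscher_inter_partIncrement`, `IsAdmissible.relativeEntropy_of_trim_eq`).

The discounted price is a local martingale exactly when `e^{X 1}` has mean `e^{r - q}`. Independence
of increments gives one direction. For the other, Fatou's lemma forces the exponential moment to be
finite, and then `e^{X⁺ 1}` dominates the localised prices (`IsAdmissible.isLocalMartingale_iff`).
Solving the moment equation for the second parameter yields the graph of `Phi` over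
`parameterInterval` (`martingaleCondition_iff`).

What remains is to minimise an explicit function of the two transformed rates on a curve. Its
sublevel sets lie in a compact rectangle, and the curve becomes a closed condition once the moment
equation is inverted (`exists_isMinOn_rateEntropy`). -/

namespace BilateralGamma

/-! ### Gamma distributions: exponential tilting and moments -/

section Gamma

variable {a b r s θ : ℝ}

lemma measurable_gammaPDF (a r : ℝ) : Measurable (gammaPDF a r) :=
  (measurable_gammaPDFReal a r).ennreal_ofReal

lemma ae_gammaMeasure_pos (a r : ℝ) : ∀ᵐ x ∂gammaMeasure a r, 0 < x := by
  rw [gammaMeasure, ae_withDensity_iff (measurable_gammaPDF a r)]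
  filter_upwards [Measure.ae_ne volume (0 : ℝ)] with x hx h
  by_contra hneg
  exact h (gammaPDF_of_neg (lt_of_le_of_ne (not_lt.mp hneg) hx))

/-- The factor `e^{θx}` is absorbed by `e^{-rx}`, so only the rate and the normalising constant
change. -/
lemma ofReal_exp_mul_gammaPDF (hr : 0 < r) (hθ : θ < r) (x : ℝ) :
    gammaPDF a r x * ENNReal.ofReal (Real.exp (θ * x)) =
      ENNReal.ofReal ((r / (r - θ)) ^ a) * gammaPDF a (r - θ) x := by
  rcases lt_or_ge x 0 with hx | hx
  · simp [gammaPDF_of_neg hx]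
  have hrθ : 0 < r - θ := sub_pos.mpr hθ
  rw [gammaPDF_of_nonneg hx, gammaPDF_of_nonneg hx, ← ENNReal.ofReal_mul' (Real.exp_pos _).le,
    ← ENNReal.ofReal_mul (by positivity), Real.div_rpow hr.le hrθ.le,
    show -((r - θ) * x) = -(r * x) + θ * x by ring, Real.exp_add]
  have : (r - θ) ^ a ≠ 0 := by positivity
  congr 1
  field_simp

lemma withDensity_exp_gammaMeasure (hr : 0 < r) (hθ : θ < r) :
    (gammaMeasure a r).withDensity (fun x => ENNReal.ofReal (Real.exp (θ * x))) =
      ENNReal.ofReal ((r / (r - θ)) ^ a) • gammaMeasure a (r - θ) := by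
  rw [gammaMeasure, ← withDensity_mul _ (measurable_gammaPDF a r) (by fun_prop), gammaMeasure,
    ← withDensity_smul _ (measurable_gammaPDF a _)]
  congr 1
  ext x
  exact ofReal_exp_mul_gammaPDF hr hθ x

lemma lintegral_exp_gammaMeasure (ha : 0 < a) (hr : 0 < r) (hθ : θ < r) :
    ∫⁻ x, ENNReal.ofReal (Real.exp (θ * x)) ∂gammaMeasure a r =
      ENNReal.ofReal ((r / (r - θ)) ^ a) := by
  have := isProbabilityMeasure_gammaMeasure ha (sub_pos.mpr hθ)
  rw [← setLIntegral_univ, ← withDensity_apply _ .univ, withDensity_exp_gammaMeasure hr hθ]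
  simp

/-- The law lives on `(0, ∞)`, so the integral dominates the transform at every `u < r`, and that
blows up as `u ↑ r`. -/
lemma lintegral_exp_gammaMeasure_eq_top (ha : 0 < a) (hr : 0 < r) (hθ : r ≤ θ) :
    ∫⁻ x, ENNReal.ofReal (Real.exp (θ * x)) ∂gammaMeasure a r = ⊤ := by
  have h1 : ∀ᶠ u in 𝓝[<] r, ENNReal.ofReal ((r / (r - u)) ^ a) ≤
      ∫⁻ x, ENNReal.ofReal (Real.exp (θ * x)) ∂gammaMeasure a r := by
    filter_upwards [self_mem_nhdsWithin] with u hu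
    rw [← lintegral_exp_gammaMeasure ha hr hu]
    refine lintegral_mono_ae ?_
    filter_upwards [ae_gammaMeasure_pos a r] with x hx
    gcongr
    exact (le_of_lt hu).trans hθ
  have h2 : Tendsto (fun u => ENNReal.ofReal ((r / (r - u)) ^ a)) (𝓝[<] r) (𝓝 ⊤) := by
    refine ENNReal.tendsto_ofReal_nhds_top.mpr ((tendsto_rpow_atTop ha).comp ?_)
    simp_rw [div_eq_mul_inv]
    refine Tendsto.const_mul_atTop hr (tendsto_inv_nhdsGT_zero.comp ?_)
    refine tendsto_nhdsWithin_iff.mpr ⟨?_, ?_⟩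
    · exact ((continuous_const.sub continuous_id).tendsto' r 0 (sub_self r)).mono_left
        nhdsWithin_le_nhds
    · filter_upwards [self_mem_nhdsWithin] with u hu using sub_pos.mpr (Set.mem_Iio.mp hu)
  exact top_le_iff.mp (le_of_tendsto h2 h1)

/-- The factor `x ^ s` shifts the shape from `a` to `a + s`. Used for the mean and for the mean of
the square root. -/
lemma lintegral_rpow_gammaMeasure (ha : 0 < a) (hr : 0 < r) (hs : 0 < s) :
    ∫⁻ x, ENNReal.ofReal (x ^ s) ∂gammaMeasure a r =
      ENNReal.ofReal (Real.Gamma (a + s) / (Real.Gamma a * r ^ s)) := by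
  have hG : Real.Gamma a ≠ 0 := (Real.Gamma_pos_of_pos ha).ne'
  have hG' : Real.Gamma (a + s) ≠ 0 := (Real.Gamma_pos_of_pos (add_pos ha hs)).ne'
  rw [gammaMeasure, lintegral_withDensity_eq_lintegral_mul _ (measurable_gammaPDF a r)
    (by fun_prop)]
  calc _ = ∫⁻ x, ENNReal.ofReal (Real.Gamma (a + s) / (Real.Gamma a * r ^ s)) *
        gammaPDF (a + s) r x := by
        refine lintegral_congr_ae ?_
        filter_upwards [Measure.ae_ne volume (0 : ℝ)] with x hx
        rcases lt_or_ge x 0 with h | h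
        · simp [gammaPDF_of_neg h]
        have hx' : 0 < x := lt_of_le_of_ne h hx.symm
        rw [Pi.mul_apply, gammaPDF_of_nonneg h, gammaPDF_of_nonneg h,
          ← ENNReal.ofReal_mul' (by positivity), ← ENNReal.ofReal_mul (by positivity),
          Real.rpow_add hr, show a + s - 1 = a - 1 + s by ring, Real.rpow_add hx']
        congr 1
        have : r ^ s ≠ 0 := by positivity
        field_simp
    _ = _ := by
        rw [lintegral_const_mul _ (measurable_gammaPDF _ _),
          lintegral_gammaPDF_eq_one (add_pos ha hs) hr, mul_one]

lemma lintegral_id_gammaMeasure (ha : 0 < a) (hr : 0 < r) :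
    ∫⁻ x, ENNReal.ofReal x ∂gammaMeasure a r = ENNReal.ofReal (a / r) := by
  have := lintegral_rpow_gammaMeasure ha hr one_pos
  have hG : Real.Gamma a ≠ 0 := (Real.Gamma_pos_of_pos ha).ne'
  simp only [Real.rpow_one, Real.Gamma_add_one ha.ne'] at this
  rw [this]
  congr 1
  field_simp

lemma integrable_id_gammaMeasure (ha : 0 < a) (hr : 0 < r) :
    Integrable (fun x => x) (gammaMeasure a r) := by
  refine ⟨by fun_prop, ?_⟩
  rw [hasFiniteIntegral_iff_ofReal ((ae_gammaMeasure_pos a r).mono fun x hx => hx.le),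
    lintegral_id_gammaMeasure ha hr]
  exact ENNReal.ofReal_lt_top

lemma integral_id_gammaMeasure (ha : 0 < a) (hr : 0 < r) :
    ∫ x, x ∂gammaMeasure a r = a / r := by
  rw [integral_eq_lintegral_of_nonneg_ae ((ae_gammaMeasure_pos a r).mono fun x hx => hx.le)
    (by fun_prop), lintegral_id_gammaMeasure ha hr, ENNReal.toReal_ofReal (by positivity)]

end Gamma

/-! ### Identification of laws by exponential moments; the Gamma convolution semigroup -/

lemma mgf_id_eq_toReal_lintegral (μ : Measure ℝ) (θ : ℝ) :
    mgf id μ θ = (∫⁻ x, ENNReal.ofReal (Real.exp (θ * x)) ∂μ).toReal := by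
  rw [mgf, integral_eq_lintegral_of_nonneg_ae (ae_of_all _ fun x => (Real.exp_pos _).le)
    (by fun_prop)]
  rfl

lemma integrable_exp_mul_iff (μ : Measure ℝ) (θ : ℝ) :
    Integrable (fun x => Real.exp (θ * x)) μ ↔
      ∫⁻ x, ENNReal.ofReal (Real.exp (θ * x)) ∂μ < ⊤ := by
  rw [← hasFiniteIntegral_iff_ofReal (ae_of_all _ fun x => (Real.exp_pos _).le)]
  exact ⟨fun h => h.2, fun h => ⟨by fun_prop, h⟩⟩

/-- Finiteness near `0` makes the moment generating function analytic on a strip around the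
imaginary axis, so it determines the characteristic function. Working in `[0, ∞]` lets infinite
values be compared as well. -/
lemma eq_of_lintegral_exp_eq {μ ν : Measure ℝ} [IsProbabilityMeasure μ] [IsProbabilityMeasure ν]
    {ε : ℝ} (hε : 0 < ε)
    (hfin : ∀ θ, |θ| < ε → ∫⁻ x, ENNReal.ofReal (Real.exp (θ * x)) ∂μ < ⊤)
    (h : ∀ θ, ∫⁻ x, ENNReal.ofReal (Real.exp (θ * x)) ∂μ =
      ∫⁻ x, ENNReal.ofReal (Real.exp (θ * x)) ∂ν) : μ = ν := by
  have hmgf : mgf id μ = mgf id ν := by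
    ext θ
    rw [mgf_id_eq_toReal_lintegral, mgf_id_eq_toReal_lintegral, h]
  have h0 : (0 : ℝ) ∈ interior (integrableExpSet id μ) := by
    refine mem_interior.mpr ⟨Metric.ball 0 ε, fun θ hθ => ?_, Metric.isOpen_ball, by simpa⟩
    exact (integrable_exp_mul_iff μ θ).mpr (hfin θ (by simpa using hθ))
  refine Measure.ext_of_charFun (funext fun t => ?_)
  rw [← complexMGF_id_mul_I, ← complexMGF_id_mul_I]
  exact eqOn_complexMGF_of_mgf hmgf (by simpa using h0)

lemma lintegral_exp_conv (μ ν : Measure ℝ) [SFinite μ] [SFinite ν] (θ : ℝ) :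
    ∫⁻ x, ENNReal.ofReal (Real.exp (θ * x)) ∂(μ.conv ν) =
      (∫⁻ x, ENNReal.ofReal (Real.exp (θ * x)) ∂μ) *
        ∫⁻ x, ENNReal.ofReal (Real.exp (θ * x)) ∂ν := by
  rw [Measure.lintegral_conv (by fun_prop), ← lintegral_mul_const _ (by fun_prop)]
  refine lintegral_congr fun x => ?_
  rw [← lintegral_const_mul _ (by fun_prop)]
  refine lintegral_congr fun y => ?_
  rw [mul_add, Real.exp_add, ENNReal.ofReal_mul (Real.exp_pos _).le]

lemma gammaMeasure_conv {a b r : ℝ} (ha : 0 < a) (hb : 0 < b) (hr : 0 < r) :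
    (gammaMeasure a r).conv (gammaMeasure b r) = gammaMeasure (a + b) r := by
  have := isProbabilityMeasure_gammaMeasure ha hr
  have := isProbabilityMeasure_gammaMeasure hb hr
  have := isProbabilityMeasure_gammaMeasure (add_pos ha hb) hr
  symm
  refine eq_of_lintegral_exp_eq hr (fun θ hθ => ?_) fun θ => ?_
  · rw [lintegral_exp_gammaMeasure (add_pos ha hb) hr (lt_of_abs_lt hθ)]
    exact ENNReal.ofReal_lt_top
  · rw [lintegral_exp_conv]
    rcases lt_or_ge θ r with hθ | hθ
    · have : 0 < r / (r - θ) := div_pos hr (sub_pos.mpr hθ)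
      rw [lintegral_exp_gammaMeasure (add_pos ha hb) hr hθ, lintegral_exp_gammaMeasure ha hr hθ,
        lintegral_exp_gammaMeasure hb hr hθ, ← ENNReal.ofReal_mul (by positivity),
        Real.rpow_add this]
    · rw [lintegral_exp_gammaMeasure_eq_top (add_pos ha hb) hr hθ,
        lintegral_exp_gammaMeasure_eq_top ha hr hθ, lintegral_exp_gammaMeasure_eq_top hb hr hθ,
        ENNReal.top_mul_top]

lemma norm_exp_mul_I_sub_exp_mul_I_le (x y : ℝ) :
    ‖Complex.exp (x * Complex.I) - Complex.exp (y * Complex.I)‖ ≤ |x - y| := by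
  have h : Complex.exp (x * Complex.I) - Complex.exp (y * Complex.I) =
      Complex.exp (y * Complex.I) * (Complex.exp (Complex.I * ((x - y : ℝ) : ℂ)) - 1) := by
    rw [mul_sub, ← Complex.exp_add, mul_one]
    congr 2
    push_cast
    ring
  rw [h, norm_mul, Complex.norm_exp_ofReal_mul_I, one_mul]
  exact Real.norm_exp_I_mul_ofReal_sub_one_le

/-- The map `x ↦ e^{iux}` is `|u|`-Lipschitz, so the mean `a / r` controls the distance to `1`. -/
lemma norm_charFun_gammaMeasure_sub_one_le {a r : ℝ} (ha : 0 < a) (hr : 0 < r) (u : ℝ) :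
    ‖charFun (gammaMeasure a r) u - 1‖ ≤ |u| * (a / r) := by
  have := isProbabilityMeasure_gammaMeasure ha hr
  have hint : Integrable (fun x : ℝ => Complex.exp (u * x * Complex.I)) (gammaMeasure a r) :=
    Integrable.of_bound (by fun_prop) 1 (ae_of_all _ fun x => by
      rw [← Complex.ofReal_mul, Complex.norm_exp_ofReal_mul_I])
  have h1 : charFun (gammaMeasure a r) u - 1 =
      ∫ x : ℝ, (Complex.exp (u * x * Complex.I) - 1) ∂gammaMeasure a r := by
    rw [integral_sub hint (integrable_const _), charFun_apply_real]
    simp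
  rw [h1, ← integral_id_gammaMeasure ha hr, ← integral_const_mul]
  refine norm_integral_le_of_norm_le ((integrable_id_gammaMeasure ha hr).const_mul _) ?_
  filter_upwards [ae_gammaMeasure_pos a r] with x hx
  have := norm_exp_mul_I_sub_exp_mul_I_le (u * x) 0
  simp only [Complex.ofReal_zero, zero_mul, Complex.exp_zero, sub_zero, abs_mul, abs_of_pos hx]
    at this
  simpa using this

lemma charFun_gammaMeasure_add {a b r : ℝ} (ha : 0 < a) (hb : 0 < b) (hr : 0 < r) (u : ℝ) :
    charFun (gammaMeasure (a + b) r) u =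
      charFun (gammaMeasure a r) u * charFun (gammaMeasure b r) u := by
  have := isProbabilityMeasure_gammaMeasure ha hr
  have := isProbabilityMeasure_gammaMeasure hb hr
  rw [← gammaMeasure_conv ha hb hr, charFun_conv]

lemma charFun_gammaMeasure_nat_mul {a r : ℝ} (ha : 0 < a) (hr : 0 < r) (u : ℝ) {n : ℕ}
    (hn : n ≠ 0) : charFun (gammaMeasure (n * a) r) u = charFun (gammaMeasure a r) u ^ n := by
  induction n, Nat.one_le_iff_ne_zero.mpr hn using Nat.le_induction with
  | base => simp
  | succ n hn ih =>
    have hn' : (0 : ℝ) < n := by exact_mod_cast Nat.pos_of_ne_zero (by omega)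
    rw [show ((n + 1 : ℕ) : ℝ) * a = n * a + a by push_cast; ring,
      charFun_gammaMeasure_add (by positivity) ha hr, ih (by omega), pow_succ]

lemma norm_charFun_gammaMeasure_add_sub_le {a b r : ℝ} (ha : 0 < a) (hb : 0 < b) (hr : 0 < r)
    (u : ℝ) : ‖charFun (gammaMeasure (a + b) r) u - charFun (gammaMeasure a r) u‖ ≤
      |u| * (b / r) := by
  have := isProbabilityMeasure_gammaMeasure ha hr
  rw [charFun_gammaMeasure_add ha hb hr]
  calc _ = ‖charFun (gammaMeasure a r) u‖ * ‖charFun (gammaMeasure b r) u - 1‖ := by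
        rw [← norm_mul]; ring_nf
    _ ≤ 1 * (|u| * (b / r)) := by
        gcongr
        · exact norm_charFun_le_one u
        · exact norm_charFun_gammaMeasure_sub_one_le hb hr u
    _ = _ := one_mul _

/-! ### Transforms of bilateral Gamma distributions -/

section BilateralGammaMeasure

variable {αp ℓp αm ℓm : ℝ}

lemma isProbabilityMeasure_bilateralGammaMeasure (hαp : 0 < αp) (hℓp : 0 < ℓp) (hαm : 0 < αm)
    (hℓm : 0 < ℓm) : IsProbabilityMeasure (bilateralGammaMeasure αp ℓp αm ℓm) := by
  have := isProbabilityMeasure_gammaMeasure hαp hℓp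
  have := isProbabilityMeasure_gammaMeasure hαm hℓm
  exact Measure.isProbabilityMeasure_map (by fun_prop)

lemma lintegral_exp_bilateralGammaMeasure (hαp : 0 < αp) (hℓp : 0 < ℓp) (hαm : 0 < αm)
    (hℓm : 0 < ℓm) (θ : ℝ) :
    ∫⁻ x, ENNReal.ofReal (Real.exp (θ * x)) ∂bilateralGammaMeasure αp ℓp αm ℓm =
      (∫⁻ x, ENNReal.ofReal (Real.exp (θ * x)) ∂gammaMeasure αp ℓp) *
        ∫⁻ x, ENNReal.ofReal (Real.exp (-θ * x)) ∂gammaMeasure αm ℓm := by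
  have := isProbabilityMeasure_gammaMeasure hαp hℓp
  have := isProbabilityMeasure_gammaMeasure hαm hℓm
  rw [bilateralGammaMeasure, lintegral_map (by fun_prop) (by fun_prop),
    ← lintegral_prod_mul (by fun_prop) (by fun_prop)]
  refine lintegral_congr fun x => ?_
  rw [← ENNReal.ofReal_mul (Real.exp_pos _).le, ← Real.exp_add]
  ring_nf

lemma charFun_bilateralGammaMeasure (hαp : 0 < αp) (hℓp : 0 < ℓp) (hαm : 0 < αm)
    (hℓm : 0 < ℓm) (u : ℝ) :
    charFun (bilateralGammaMeasure αp ℓp αm ℓm) u =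
      charFun (gammaMeasure αp ℓp) u * charFun (gammaMeasure αm ℓm) (-u) := by
  have := isProbabilityMeasure_gammaMeasure hαp hℓp
  have := isProbabilityMeasure_gammaMeasure hαm hℓm
  rw [charFun_apply_real, bilateralGammaMeasure, integral_map (by fun_prop) (by fun_prop),
    charFun_apply_real, charFun_apply_real, ← integral_prod_mul]
  refine integral_congr_ae (ae_of_all _ fun x => ?_)
  simp only
  rw [← Complex.exp_add]
  push_cast
  ring_nf

lemma charFun_bilateralGammaMeasure_nat_mul (hαp : 0 < αp) (hℓp : 0 < ℓp) (hαm : 0 < αm)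
    (hℓm : 0 < ℓm) (u : ℝ) {n : ℕ} (hn : n ≠ 0) :
    charFun (bilateralGammaMeasure (n * αp) ℓp (n * αm) ℓm) u =
      charFun (bilateralGammaMeasure αp ℓp αm ℓm) u ^ n := by
  have hn' : (0 : ℝ) < n := by exact_mod_cast Nat.pos_of_ne_zero hn
  rw [charFun_bilateralGammaMeasure (by positivity) hℓp (by positivity) hℓm,
    charFun_bilateralGammaMeasure hαp hℓp hαm hℓm, charFun_gammaMeasure_nat_mul hαp hℓp _ hn,
    charFun_gammaMeasure_nat_mul hαm hℓm _ hn, mul_pow]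

lemma lintegral_exp_gammaMeasure_nat_mul {a r : ℝ} (ha : 0 < a) (hr : 0 < r) (θ : ℝ) {n : ℕ}
    (hn : n ≠ 0) :
    ∫⁻ x, ENNReal.ofReal (Real.exp (θ * x)) ∂gammaMeasure (n * a) r =
      (∫⁻ x, ENNReal.ofReal (Real.exp (θ * x)) ∂gammaMeasure a r) ^ n := by
  have hn' : (0 : ℝ) < n := by exact_mod_cast Nat.pos_of_ne_zero hn
  rcases lt_or_ge θ r with hθ | hθ
  · have : 0 < r / (r - θ) := div_pos hr (sub_pos.mpr hθ)
    rw [lintegral_exp_gammaMeasure (by positivity) hr hθ, lintegral_exp_gammaMeasure ha hr hθ,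
      ← ENNReal.ofReal_pow (by positivity), ← Real.rpow_natCast, ← Real.rpow_mul this.le,
      mul_comm a]
  · rw [lintegral_exp_gammaMeasure_eq_top (by positivity) hr hθ,
      lintegral_exp_gammaMeasure_eq_top ha hr hθ, ENNReal.top_pow hn]

lemma lintegral_exp_bilateralGammaMeasure_nat_mul (hαp : 0 < αp) (hℓp : 0 < ℓp) (hαm : 0 < αm)
    (hℓm : 0 < ℓm) (θ : ℝ) {n : ℕ} (hn : n ≠ 0) :
    ∫⁻ x, ENNReal.ofReal (Real.exp (θ * x)) ∂bilateralGammaMeasure (n * αp) ℓp (n * αm) ℓm =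
      (∫⁻ x, ENNReal.ofReal (Real.exp (θ * x)) ∂bilateralGammaMeasure αp ℓp αm ℓm) ^ n := by
  have hn' : (0 : ℝ) < n := by exact_mod_cast Nat.pos_of_ne_zero hn
  rw [lintegral_exp_bilateralGammaMeasure (by positivity) hℓp (by positivity) hℓm,
    lintegral_exp_bilateralGammaMeasure hαp hℓp hαm hℓm,
    lintegral_exp_gammaMeasure_nat_mul hαp hℓp _ hn,
    lintegral_exp_gammaMeasure_nat_mul hαm hℓm _ hn, mul_pow]

lemma lintegral_exp_bilateralGammaMeasure_lt_top (hαp : 0 < αp) (hℓp : 0 < ℓp) (hαm : 0 < αm)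
    (hℓm : 0 < ℓm) {θ : ℝ} (h1 : θ < ℓp) (h2 : -θ < ℓm) :
    ∫⁻ x, ENNReal.ofReal (Real.exp (θ * x)) ∂bilateralGammaMeasure αp ℓp αm ℓm < ⊤ := by
  rw [lintegral_exp_bilateralGammaMeasure hαp hℓp hαm hℓm, lintegral_exp_gammaMeasure hαp hℓp h1,
    lintegral_exp_gammaMeasure hαm hℓm h2]
  exact ENNReal.mul_lt_top ENNReal.ofReal_lt_top ENNReal.ofReal_lt_top

/-- The characteristic function depends continuously on the shape parameters. -/
lemma norm_charFun_bilateralGammaMeasure_add_sub_le {a b : ℝ} (hαp : 0 < αp) (hℓp : 0 < ℓp)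
    (hαm : 0 < αm) (hℓm : 0 < ℓm) (ha : 0 < a) (hb : 0 < b) (u : ℝ) :
    ‖charFun (bilateralGammaMeasure (αp + a) ℓp (αm + b) ℓm) u -
      charFun (bilateralGammaMeasure αp ℓp αm ℓm) u‖ ≤ |u| * (a / ℓp) + |u| * (b / ℓm) := by
  have := isProbabilityMeasure_gammaMeasure (add_pos hαp ha) hℓp
  have := isProbabilityMeasure_gammaMeasure hαm hℓm
  rw [charFun_bilateralGammaMeasure (by positivity) hℓp (by positivity) hℓm,
    charFun_bilateralGammaMeasure hαp hℓp hαm hℓm]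
  set x := charFun (gammaMeasure αp ℓp) u
  set x' := charFun (gammaMeasure (αp + a) ℓp) u with hx'
  set y := charFun (gammaMeasure αm ℓm) (-u) with hy
  set y' := charFun (gammaMeasure (αm + b) ℓm) (-u)
  calc ‖x' * y' - x * y‖ = ‖(x' - x) * y + x' * (y' - y)‖ := by ring_nf
    _ ≤ ‖x' - x‖ * ‖y‖ + ‖x'‖ * ‖y' - y‖ := by
      rw [← norm_mul, ← norm_mul]; exact norm_add_le _ _
    _ ≤ (|u| * (a / ℓp)) * 1 + 1 * (|-u| * (b / ℓm)) := by
      gcongr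
      · exact norm_charFun_gammaMeasure_add_sub_le hαp ha hℓp u
      · exact norm_charFun_le_one _
      · exact norm_charFun_le_one _
      · exact norm_charFun_gammaMeasure_add_sub_le hαm hb hℓm (-u)
    _ = _ := by rw [abs_neg]; ring

end BilateralGammaMeasure

/-! ### Marginal laws of a bilateral Gamma process -/

section Levy

variable {Ω : Type*} {mΩ : MeasurableSpace Ω} {P : Measure Ω} [IsProbabilityMeasure P]
  {𝓕 : Filtration ℝ≥0 mΩ} {X : ℝ≥0 → Ω → ℝ}

lemma IsLevyProcess.measurable {Q : ℝ≥0 → Measure Ω} (hX : IsLevyProcess 𝓕 Q X) (t : ℝ≥0) :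
    Measurable (X t) :=
  (hX.adapted t).mono (𝓕.le t) le_rfl

lemma IsLevyProcess.map_add (hX : IsLevyProcess 𝓕 (fun _ => P) X) (s t : ℝ≥0) :
    P.map (X (s + t)) = (P.map (X s)).conv (P.map (X t)) := by
  have hind : IndepFun (X s) (fun ω => X (s + t) ω - X s ω) P := by
    refine indep_of_indep_of_le_left (hX.indep s (s + t) le_self_add) ?_
    exact (hX.adapted s).comap_le
  have h := hind.map_add_eq_map_conv_map (hX.measurable s)
    ((hX.measurable _).sub (hX.measurable _))
  have hst : P.map (X (s + t) - X s) = P.map (X t) := hX.stationary s t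
  rwa [hst, add_sub_cancel] at h

lemma IsLevyProcess.map_zero (hX : IsLevyProcess 𝓕 (fun _ => P) X) :
    P.map (X 0) = Measure.dirac 0 := by
  rw [Measure.map_congr (g := fun _ => (0 : ℝ)) hX.zero, Measure.map_const]
  simp

lemma IsLevyProcess.charFun_map_nat_mul (hX : IsLevyProcess 𝓕 (fun _ => P) X) (t : ℝ≥0) (u : ℝ)
    (n : ℕ) : charFun (P.map (X (n * t))) u = charFun (P.map (X t)) u ^ n := by
  have hm (t : ℝ≥0) : IsProbabilityMeasure (P.map (X t)) :=
    Measure.isProbabilityMeasure_map (hX.measurable t).aemeasurable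
  induction n with
  | zero => simp [hX.map_zero, charFun_dirac]
  | succ n ih =>
    rw [show ((n + 1 : ℕ) : ℝ≥0) * t = n * t + t by push_cast; ring, hX.map_add, charFun_conv, ih,
      pow_succ]

lemma IsLevyProcess.lintegral_exp_map_nat_mul (hX : IsLevyProcess 𝓕 (fun _ => P) X) (t : ℝ≥0)
    (θ : ℝ) (n : ℕ) : ∫⁻ x, ENNReal.ofReal (Real.exp (θ * x)) ∂(P.map (X (n * t))) =
      (∫⁻ x, ENNReal.ofReal (Real.exp (θ * x)) ∂(P.map (X t))) ^ n := by
  have hm (t : ℝ≥0) : IsProbabilityMeasure (P.map (X t)) :=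
    Measure.isProbabilityMeasure_map (hX.measurable t).aemeasurable
  induction n with
  | zero => simp [hX.map_zero]
  | succ n ih =>
    rw [show ((n + 1 : ℕ) : ℝ≥0) * t = n * t + t by push_cast; ring, hX.map_add,
      lintegral_exp_conv, ih, pow_succ]

variable {αp ℓp αm ℓm : ℝ}

/-- Only the `n`-th convolution power of this law is known. Exponential moments take values in `[0,
∞]`, where `n`-th roots are unique; characteristic functions would leave the choice of a complex
root. -/
lemma IsBilateralGammaProcess.map_inv_nat
    (hX : IsBilateralGammaProcess 𝓕 (fun _ => P) X αp ℓp αm ℓm)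
    (hαp : 0 < αp) (hℓp : 0 < ℓp) (hαm : 0 < αm) (hℓm : 0 < ℓm) {n : ℕ} (hn : n ≠ 0) :
    P.map (X (n : ℝ≥0)⁻¹) = bilateralGammaMeasure ((n : ℝ)⁻¹ * αp) ℓp ((n : ℝ)⁻¹ * αm) ℓm := by
  have hn' : (0 : ℝ) < n := by exact_mod_cast Nat.pos_of_ne_zero hn
  have : IsProbabilityMeasure (P.map (X (n : ℝ≥0)⁻¹)) :=
    Measure.isProbabilityMeasure_map (hX.1.measurable _).aemeasurable
  have hp : 0 < (n : ℝ)⁻¹ * αp := by positivity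
  have hm : 0 < (n : ℝ)⁻¹ * αm := by positivity
  have := isProbabilityMeasure_bilateralGammaMeasure hp hℓp hm hℓm
  symm
  refine eq_of_lintegral_exp_eq (lt_min hℓp hℓm) (fun θ hθ => ?_) fun θ => ?_
  · obtain ⟨h1, h2⟩ := lt_min_iff.mp hθ
    exact lintegral_exp_bilateralGammaMeasure_lt_top hp hℓp hm hℓm (lt_of_abs_lt h1)
      ((neg_le_abs θ).trans_lt h2)
  · refine (ENNReal.pow_right_strictMono hn).injective ?_
    rw [← lintegral_exp_bilateralGammaMeasure_nat_mul hp hℓp hm hℓm _ hn,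
      ← hX.1.lintegral_exp_map_nat_mul, mul_inv_cancel₀ (by exact_mod_cast hn), hX.2,
      mul_inv_cancel_left₀ hn'.ne', mul_inv_cancel_left₀ hn'.ne']

lemma IsLevyProcess.tendsto_charFun_map (hX : IsLevyProcess 𝓕 (fun _ => P) X) {t : ℝ≥0}
    {v : ℕ → ℝ≥0} (hv : Tendsto v atTop (𝓝 t)) (htv : ∀ n, t ≤ v n) (u : ℝ) :
    Tendsto (fun n => charFun (P.map (X (v n))) u) atTop (𝓝 (charFun (P.map (X t)) u)) := by
  have h (s : ℝ≥0) : charFun (P.map (X s)) u = ∫ ω, Complex.exp (u * X s ω * Complex.I) ∂P := by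
    rw [charFun_apply_real, integral_map (hX.measurable s).aemeasurable (by fun_prop)]
  simp_rw [h]
  have hmeas := hX.measurable
  refine tendsto_integral_of_dominated_convergence (fun _ => 1) (fun n => by fun_prop)
    (integrable_const _) (fun n => ae_of_all _ fun ω => ?_) (ae_of_all _ fun ω => ?_)
  · rw [← Complex.ofReal_mul, Complex.norm_exp_ofReal_mul_I]
  · have hv' : Tendsto v atTop (𝓝[≥] t) :=
      tendsto_nhdsWithin_iff.mpr ⟨hv, Eventually.of_forall htv⟩
    have h1 : Tendsto (fun n => X (v n) ω) atTop (𝓝 (X t ω)) :=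
      (hX.right_continuous ω t).tendsto.comp hv'
    have h2 : Continuous fun x : ℝ => Complex.exp (u * x * Complex.I) := by fun_prop
    exact (h2.tendsto _).comp h1

/-- The marginal distributions of a bilateral Gamma process. -/
theorem IsBilateralGammaProcess.map_eq
    (hX : IsBilateralGammaProcess 𝓕 (fun _ => P) X αp ℓp αm ℓm)
    (hαp : 0 < αp) (hℓp : 0 < ℓp) (hαm : 0 < αm) (hℓm : 0 < ℓm) {t : ℝ≥0} (ht : 0 < t) :
    P.map (X t) = bilateralGammaMeasure (αp * t) ℓp (αm * t) ℓm := by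
  have : IsProbabilityMeasure (P.map (X t)) :=
    Measure.isProbabilityMeasure_map (hX.1.measurable _).aemeasurable
  have ht' : (0 : ℝ) < t := ht
  have := isProbabilityMeasure_bilateralGammaMeasure (mul_pos hαp ht') hℓp (mul_pos hαm ht') hℓm
  refine Measure.ext_of_charFun (funext fun u => ?_)
  -- The times `v n = (⌊(n + 1) t⌋ + 1) / (n + 1)` are rational and strictly to the right of `t`:
  -- right continuity applies, and `v n - t` gives positive increments of the shapes.
  let k : ℕ → ℕ := fun n => ⌊((n + 1 : ℕ) : ℝ≥0) * t⌋₊ + 1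
  let v : ℕ → ℝ≥0 := fun n => k n * ((n + 1 : ℕ) : ℝ≥0)⁻¹
  have hpos (n : ℕ) : (0 : ℝ≥0) < ((n + 1 : ℕ) : ℝ≥0) := by positivity
  have hlt (n : ℕ) : t < v n := by
    have : ((n + 1 : ℕ) : ℝ≥0) * t < k n := by
      simp only [k, Nat.cast_add, Nat.cast_one]
      exact_mod_cast Nat.lt_floor_add_one _
    simp only [v]
    rw [← div_eq_mul_inv, lt_div_iff₀ (hpos n), mul_comm]
    exact this
  have hle (n : ℕ) : v n ≤ t + ((n + 1 : ℕ) : ℝ≥0)⁻¹ := by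
    have : (k n : ℝ≥0) ≤ ((n + 1 : ℕ) : ℝ≥0) * t + 1 := by
      simp only [k]
      push_cast
      gcongr
      exact_mod_cast Nat.floor_le (a := ((n + 1 : ℕ) : ℝ≥0) * t) zero_le
    simp only [v]
    rw [← div_eq_mul_inv, div_le_iff₀ (hpos n), add_mul, inv_mul_cancel₀ (hpos n).ne', mul_comm t]
    exact this
  have hlim0 : Tendsto (fun n : ℕ => ((n + 1 : ℕ) : ℝ≥0)⁻¹) atTop (𝓝 0) :=
    tendsto_inv_atTop_nhds_zero_nat.comp (tendsto_add_atTop_nat 1)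
  have hv : Tendsto v atTop (𝓝 t) := by
    refine tendsto_of_tendsto_of_tendsto_of_le_of_le tendsto_const_nhds ?_
      (fun n => (hlt n).le) hle
    simpa using hlim0.const_add t
  have hchar (n : ℕ) : charFun (P.map (X (v n))) u =
      charFun (bilateralGammaMeasure (αp * v n) ℓp (αm * v n) ℓm) u := by
    have hn' : (0 : ℝ) < ((n + 1 : ℕ) : ℝ) := by positivity
    simp only [v]
    rw [hX.1.charFun_map_nat_mul, hX.map_inv_nat hαp hℓp hαm hℓm n.succ_ne_zero,
      ← charFun_bilateralGammaMeasure_nat_mul (by positivity) hℓp (by positivity) hℓm u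
        (Nat.succ_ne_zero _ : k n ≠ 0)]
    congr 2 <;> · rw [NNReal.coe_mul, NNReal.coe_inv, NNReal.coe_natCast, NNReal.coe_natCast]; ring
  refine tendsto_nhds_unique (hX.1.tendsto_charFun_map hv (fun n => (hlt n).le) u) ?_
  simp_rw [hchar]
  rw [tendsto_iff_norm_sub_tendsto_zero]
  have hvr : Tendsto (fun n => (v n : ℝ)) atTop (𝓝 t) := NNReal.tendsto_coe.mpr hv
  have hbound : Tendsto (fun n => |u| * (αp * (v n - t) / ℓp) + |u| * (αm * (v n - t) / ℓm)) atTop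
      (𝓝 0) := by
    have h1 : Continuous fun y : ℝ => |u| * (αp * (y - t) / ℓp) + |u| * (αm * (y - t) / ℓm) := by
      fun_prop
    simpa [Function.comp_def] using (h1.tendsto t).comp hvr
  refine squeeze_zero (fun _ => norm_nonneg _) (fun n => ?_) hbound
  have hd : (0 : ℝ) < v n - t := sub_pos.mpr (hlt n)
  have h2 := norm_charFun_bilateralGammaMeasure_add_sub_le (mul_pos hαp ht') hℓp (mul_pos hαm ht')
    hℓm (mul_pos hαp hd) (mul_pos hαm hd) u
  rwa [← mul_add, ← mul_add, add_sub_cancel] at h2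

end Levy

/-! ### Positive variation of right-continuous paths as a limit along partitions -/

section PositiveVariation

lemma ofReal_sub_le_sum_Ico (y : ℕ → ℝ) {a b : ℕ} (h : a ≤ b) :
    ENNReal.ofReal (y b - y a) ≤ ∑ i ∈ Finset.Ico a b, ENNReal.ofReal (y (i + 1) - y i) := by
  induction b, h using Nat.le_induction with
  | base => simp
  | succ b hb ih =>
    rw [Finset.sum_Ico_succ_top hb]
    calc _ = ENNReal.ofReal ((y b - y a) + (y (b + 1) - y b)) := by ring_nf
      _ ≤ _ := ENNReal.ofReal_add_le
      _ ≤ _ := by gcongr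

/-- Subadditivity of the positive part: dropping partition points can only decrease the sum. -/
lemma sum_ofReal_sub_comp_le (y : ℕ → ℝ) {k : ℕ → ℕ} (hk : Monotone k) (m : ℕ) :
    ∑ j ∈ Finset.range m, ENNReal.ofReal (y (k (j + 1)) - y (k j)) ≤
      ∑ i ∈ Finset.Ico (k 0) (k m), ENNReal.ofReal (y (i + 1) - y i) := by
  induction m with
  | zero => simp
  | succ m ih =>
    rw [Finset.sum_range_succ, ← Finset.sum_Ico_consecutive _ (hk m.zero_le) (hk m.le_succ)]
    gcongr
    exact ofReal_sub_le_sum_Ico y (hk m.le_succ)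

/-- For a right-continuous function, the variation along partitions whose mesh tends to `0`
converges to the variation. -/
theorem tendsto_sum_positiveVariation {x : ℝ≥0 → ℝ}
    (hx : ∀ t, ContinuousWithinAt x (Set.Ici t) t) {t : ℝ≥0} {p : ℕ → ℕ → ℝ≥0} {K : ℕ → ℕ}
    {δ : ℕ → ℝ≥0} (hδ : Tendsto δ atTop (𝓝 0)) (hmono : ∀ n, Monotone (p n))
    (hle : ∀ n i, p n i ≤ t) (h0 : ∀ n, p n 0 = 0) (hK : ∀ n, p n (K n) = t)
    (hmesh : ∀ n i, p n (i + 1) ≤ p n i + δ n) :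
    Tendsto (fun n => ∑ i ∈ Finset.range (K n), ENNReal.ofReal (x (p n (i + 1)) - x (p n i)))
      atTop (𝓝 (positiveVariation x t)) := by
  refine tendsto_order.2 ⟨fun c hc => ?_, fun c hc => Eventually.of_forall fun n => ?_⟩
  · obtain ⟨⟨m, u, hu, hut⟩, hcu⟩ := lt_iSup_iff.mp hc
    simp only at hcu
    -- The index of the first point of the `n`-th partition that is not before `u j`. That point
    -- exceeds `u j` by at most `δ n`, so right continuity suffices for convergence.
    let k : ℕ → ℕ → ℕ := fun n j => sInf {i | u j ≤ p n i}
    have hmem (n j) : K n ∈ {i | u j ≤ p n i} := by simpa [hK n] using hut j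
    have hk1 (n j) : u j ≤ p n (k n j) := Nat.sInf_mem ⟨_, hmem n j⟩
    have hkK (n j) : k n j ≤ K n := Nat.sInf_le (hmem n j)
    have hkmono (n) : Monotone (k n) := fun i j hij =>
      Nat.sInf_le ((hu hij).trans (hk1 n j))
    have hk2 (n j) : p n (k n j) ≤ u j + δ n := by
      rcases Nat.eq_zero_or_eq_succ_pred (k n j) with h | h
      · rw [h, h0]; exact zero_le
      · rw [h]
        have : p n (k n j).pred < u j := by
          by_contra! hcon
          have : k n j ≤ (k n j).pred := Nat.sInf_le hcon
          omega
        exact (hmesh n _).trans (by gcongr)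
    have hconv (j) : Tendsto (fun n => x (p n (k n j))) atTop (𝓝 (x (u j))) := by
      refine (hx (u j)).tendsto.comp (tendsto_nhdsWithin_iff.mpr
        ⟨?_, Eventually.of_forall fun n => hk1 n j⟩)
      refine tendsto_of_tendsto_of_tendsto_of_le_of_le tendsto_const_nhds ?_
        (fun n => hk1 n j) (fun n => hk2 n j)
      simpa using hδ.const_add (u j)
    have hsum : Tendsto (fun n => ∑ j ∈ Finset.range m,
        ENNReal.ofReal (x (p n (k n (j + 1))) - x (p n (k n j)))) atTop
        (𝓝 (∑ j ∈ Finset.range m, ENNReal.ofReal (x (u (j + 1)) - x (u j)))) :=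
      tendsto_finsetSum _ fun j _ => ENNReal.tendsto_ofReal ((hconv _).sub (hconv _))
    filter_upwards [hsum.eventually_const_lt hcu] with n hn
    refine hn.trans_le ((sum_ofReal_sub_comp_le (fun i => x (p n i)) (hkmono n) m).trans ?_)
    refine Finset.sum_le_sum_of_subset fun i hi => ?_
    rw [Finset.mem_Ico] at hi
    exact Finset.mem_range.mpr (hi.2.trans_le (hkK n m))
  · exact (le_iSup_of_le
      (⟨K n, p n, hmono n, hle n⟩ : ℕ × {u : ℕ → ℝ≥0 // Monotone u ∧ ∀ i, u i ≤ t}) le_rfl : _ ≤ positiveVariation x t).trans_lt hc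

/-- The sum of the positive increments of `x` along the partition of `[s, t]` into `n` intervals
of equal length. -/
noncomputable def stepVariation (x : ℝ≥0 → ℝ) (s t : ℝ≥0) (n : ℕ) : ℝ≥0∞ :=
  ∑ i ∈ Finset.range n,
    ENNReal.ofReal (x (s + (i + 1 : ℕ) * ((t - s) / n)) - x (s + i * ((t - s) / n)))

lemma tendsto_stepVariation_add {x : ℝ≥0 → ℝ}
    (hx : ∀ t, ContinuousWithinAt x (Set.Ici t) t) {s t : ℝ≥0} (hst : s ≤ t) :
    Tendsto (fun n => stepVariation x 0 s (n + 1) + stepVariation x s t (n + 1)) atTop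
      (𝓝 (positiveVariation x t)) := by
  -- The equidistant partitions of `[0, s]` and `[s, t]` are concatenated. The minima and the
  -- truncated subtraction switch from one to the other at index `n + 1` and keep the value `t` from
  -- index `2 * (n + 1)` on.
  let p : ℕ → ℕ → ℝ≥0 := fun n i =>
    (min i (n + 1) : ℕ) * (s / (n + 1 : ℕ)) +
      (min (i - (n + 1)) (n + 1) : ℕ) * ((t - s) / (n + 1 : ℕ))
  have hN (n : ℕ) : ((n + 1 : ℕ) : ℝ≥0) ≠ 0 := by positivity
  have hmono (n) : Monotone (p n) := fun i j hij => by
    simp only [p]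
    gcongr
  have hend (n i) (hi : 2 * (n + 1) ≤ i) : p n i = t := by
    simp only [p]
    rw [min_eq_right (by omega), min_eq_right (by omega), mul_div_cancel₀ _ (hN n),
      mul_div_cancel₀ _ (hN n), add_tsub_cancel_of_le hst]
  have key := tendsto_sum_positiveVariation (p := p) (K := fun n => 2 * (n + 1))
    (δ := fun n => s / (n + 1 : ℕ) + (t - s) / (n + 1 : ℕ)) hx (t := t) ?_ hmono
    (fun n i => ?_) (fun n => by simp [p]) (fun n => hend n _ le_rfl) (fun n i => ?_)
  · refine key.congr fun n => ?_
    rw [two_mul, Finset.sum_range_add]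
    unfold stepVariation
    congr 1
    · refine Finset.sum_congr rfl fun i hi => ?_
      have hi' := Finset.mem_range.mp hi
      have h1 : p n (i + 1) = 0 + (i + 1 : ℕ) * ((s - 0) / (n + 1 : ℕ)) := by
        simp only [p]
        rw [min_eq_left (by omega), Nat.sub_eq_zero_of_le (by omega)]
        simp
      have h2 : p n i = 0 + i * ((s - 0) / (n + 1 : ℕ)) := by
        simp only [p]
        rw [min_eq_left (by omega), Nat.sub_eq_zero_of_le (by omega)]
        simp
      rw [h1, h2]
    · refine Finset.sum_congr rfl fun i hi => ?_
      have hi' := Finset.mem_range.mp hi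
      have h1 : p n (n + 1 + i + 1) = s + (i + 1 : ℕ) * ((t - s) / (n + 1 : ℕ)) := by
        simp only [p]
        rw [min_eq_right (by omega), mul_div_cancel₀ _ (hN n),
          show n + 1 + i + 1 - (n + 1) = i + 1 by omega, min_eq_left (by omega)]
      have h2 : p n (n + 1 + i) = s + i * ((t - s) / (n + 1 : ℕ)) := by
        simp only [p]
        rw [min_eq_right (by omega), mul_div_cancel₀ _ (hN n),
          show n + 1 + i - (n + 1) = i by omega, min_eq_left (by omega)]
      rw [h1, h2]
  · have h1 : Tendsto (fun n : ℕ => ((n + 1 : ℕ) : ℝ≥0)⁻¹) atTop (𝓝 0) :=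
      tendsto_inv_atTop_nhds_zero_nat.comp (tendsto_add_atTop_nat 1)
    simp_rw [div_eq_mul_inv]
    simpa using (h1.const_mul s).add (h1.const_mul (t - s))
  · rw [← hend n (i + 2 * (n + 1)) (by omega)]
    exact hmono n (by omega)
  · simp only [p]
    have e1 : ((min (i + 1) (n + 1) : ℕ) : ℝ≥0) ≤ (min i (n + 1) : ℕ) + 1 := by
      exact_mod_cast (by omega : min (i + 1) (n + 1) ≤ min i (n + 1) + 1)
    have e2 : ((min (i + 1 - (n + 1)) (n + 1) : ℕ) : ℝ≥0) ≤
        (min (i - (n + 1)) (n + 1) : ℕ) + 1 := by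
      exact_mod_cast
        (by omega : min (i + 1 - (n + 1)) (n + 1) ≤ min (i - (n + 1)) (n + 1) + 1)
    calc _ ≤ ((min i (n + 1) : ℕ) + 1) * (s / (n + 1 : ℕ)) +
          ((min (i - (n + 1)) (n + 1) : ℕ) + 1) * ((t - s) / (n + 1 : ℕ)) := by gcongr
      _ = _ := by ring

@[simp]
lemma positiveVariation_zero (x : ℝ≥0 → ℝ) : positiveVariation x 0 = 0 := by
  refine le_antisymm (iSup_le fun p => ?_) zero_le
  have h (i) : p.2.1 i = 0 := le_antisymm (p.2.2.2 i) zero_le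
  simp [h]

lemma positiveVariation_mono (x : ℝ≥0 → ℝ) : Monotone (positiveVariation x) := fun _ t hst =>
  iSup_le fun p => le_iSup_of_le
    (⟨p.1, p.2.1, p.2.2.1, fun i => (p.2.2.2 i).trans hst⟩ :
      ℕ × {u : ℕ → ℝ≥0 // Monotone u ∧ ∀ i, u i ≤ t}) le_rfl

lemma tendsto_stepVariation_zero {x : ℝ≥0 → ℝ}
    (hx : ∀ t, ContinuousWithinAt x (Set.Ici t) t) (t : ℝ≥0) :
    Tendsto (fun n => stepVariation x 0 t (n + 1)) atTop (𝓝 (positiveVariation x t)) := by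
  refine (tendsto_stepVariation_add hx (zero_le (a := t))).congr fun n => ?_
  have : stepVariation x 0 0 (n + 1) = 0 := by simp [stepVariation]
  rw [this, zero_add]

/-- The increment of the variation is recovered from increments of `x` inside `[s, t]` alone. This
is the source of its independence from the past. -/
lemma tendsto_stepVariation {x : ℝ≥0 → ℝ}
    (hx : ∀ t, ContinuousWithinAt x (Set.Ici t) t) {s t : ℝ≥0} (hst : s ≤ t)
    (hfin : positiveVariation x s ≠ ⊤) :
    Tendsto (fun n => stepVariation x s t (n + 1)) atTop
      (𝓝 (positiveVariation x t - positiveVariation x s)) := by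
  refine (ENNReal.Tendsto.sub (tendsto_stepVariation_add hx hst) (tendsto_stepVariation_zero hx s)
    (Or.inr hfin)).congr fun n => ?_
  refine ENNReal.add_sub_cancel_left ?_
  unfold stepVariation
  exact (ENNReal.sum_lt_top.mpr fun _ _ => ENNReal.ofReal_lt_top).ne

lemma toReal_stepVariation (x : ℝ≥0 → ℝ) (s t : ℝ≥0) (n : ℕ) :
    (stepVariation x s t n).toReal = ∑ i ∈ Finset.range n,
      max (x (s + (i + 1 : ℕ) * ((t - s) / n)) - x (s + i * ((t - s) / n))) 0 := by
  unfold stepVariation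
  rw [ENNReal.toReal_sum fun _ _ => ENNReal.ofReal_ne_top]
  simp only [ENNReal.toReal_ofReal']

/-- Since `a⁺ - (-a)⁺ = a`, the difference of the two sums telescopes. -/
lemma toReal_stepVariation_sub_neg (x : ℝ≥0 → ℝ) {s t : ℝ≥0} (hst : s ≤ t) {n : ℕ} (hn : n ≠ 0) :
    (stepVariation x s t n).toReal - (stepVariation (fun u => -x u) s t n).toReal =
      x t - x s := by
  rw [toReal_stepVariation, toReal_stepVariation, ← Finset.sum_sub_distrib]
  have h (i) : max (x (s + (i + 1 : ℕ) * ((t - s) / n)) - x (s + i * ((t - s) / n))) 0 -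
      max (-x (s + (i + 1 : ℕ) * ((t - s) / n)) - -x (s + i * ((t - s) / n))) 0 =
      x (s + (i + 1 : ℕ) * ((t - s) / n)) - x (s + i * ((t - s) / n)) := by
    generalize x (s + (i + 1 : ℕ) * ((t - s) / n)) = a
    generalize x (s + i * ((t - s) / n)) = b
    rcases le_total (a - b) 0 with hab | hab
    · rw [max_eq_right hab, max_eq_left (by linarith)]; ring
    · rw [max_eq_left hab, max_eq_right (by linarith)]; ring
  simp_rw [h]
  rw [Finset.sum_range_sub (fun i : ℕ => x (s + i * ((t - s) / n)))]
  have hn' : (n : ℝ≥0) ≠ 0 := by exact_mod_cast hn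
  rw [mul_div_cancel₀ _ hn', add_tsub_cancel_of_le hst]
  simp

lemma toReal_positiveVariation_sub_neg {x : ℝ≥0 → ℝ}
    (hx : ∀ t, ContinuousWithinAt x (Set.Ici t) t) {t : ℝ≥0}
    (h1 : positiveVariation x t ≠ ⊤) (h2 : positiveVariation (fun s => -x s) t ≠ ⊤) :
    (positiveVariation x t).toReal - (positiveVariation (fun s => -x s) t).toReal = x t - x 0 := by
  have l1 := (ENNReal.tendsto_toReal h1).comp (tendsto_stepVariation_zero hx t)
  have l2 := (ENNReal.tendsto_toReal h2).comp (tendsto_stepVariation_zero (fun s => (hx s).neg) t)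
  refine tendsto_nhds_unique (l1.sub l2) ?_
  refine tendsto_const_nhds.congr fun n => ?_
  exact (toReal_stepVariation_sub_neg x zero_le n.succ_ne_zero).symm

end PositiveVariation

/-! ### Passing from `X` to `-X`, which exchanges `X⁺` and `X⁻` -/

section Negation

lemma map_neg_bilateralGammaMeasure {αp ℓp αm ℓm : ℝ} (hαp : 0 < αp) (hℓp : 0 < ℓp)
    (hαm : 0 < αm) (hℓm : 0 < ℓm) :
    (bilateralGammaMeasure αp ℓp αm ℓm).map (fun x => -x) =
      bilateralGammaMeasure αm ℓm αp ℓp := by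
  have := isProbabilityMeasure_gammaMeasure hαp hℓp
  have := isProbabilityMeasure_gammaMeasure hαm hℓm
  rw [bilateralGammaMeasure, Measure.map_map (by fun_prop) (by fun_prop), bilateralGammaMeasure,
    ← Measure.prod_swap, Measure.map_map (by fun_prop) (by fun_prop)]
  congr 1
  ext x
  simp

variable {Ω : Type*} {mΩ : MeasurableSpace Ω} {P : Measure Ω} {𝓕 : Filtration ℝ≥0 mΩ}
  {Q : ℝ≥0 → Measure Ω} {X : ℝ≥0 → Ω → ℝ}

lemma IsLevyProcess.neg (hX : IsLevyProcess 𝓕 Q X) : IsLevyProcess 𝓕 Q (fun t ω => -X t ω) where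
  adapted t := (hX.adapted t).neg
  zero := hX.zero.mono fun ω h => by simp [h]
  right_continuous ω t := (hX.right_continuous ω t).neg
  left_limits ω t := (hX.left_limits ω t).elim fun l hl => ⟨-l, hl.neg⟩
  indep s t hst := by
    refine indep_of_indep_of_le_right (hX.indep s t hst) (Measurable.comap_le ?_)
    have : (fun ω => -X t ω - -X s ω) = fun ω => -(X t ω - X s ω) := by ext ω; ring
    rw [this]
    exact (comap_measurable _).neg
  stationary s t := by
    have hmeas := hX.measurable
    have h := congrArg (Measure.map fun x : ℝ => -x) (hX.stationary s t)
    rw [Measure.map_map (by fun_prop) (by fun_prop), Measure.map_map (by fun_prop) (by fun_prop)]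
      at h
    have e : (fun ω => -X (s + t) ω - -X s ω) =
        (fun x => -x) ∘ fun ω => X (s + t) ω - X s ω := by
      ext ω
      simp only [Function.comp_apply]
      ring
    rw [e]
    exact h

lemma IsBilateralGammaProcess.neg {αp ℓp αm ℓm : ℝ}
    (hX : IsBilateralGammaProcess 𝓕 Q X αp ℓp αm ℓm)
    (hαp : 0 < αp) (hℓp : 0 < ℓp) (hαm : 0 < αm) (hℓm : 0 < ℓm) :
    IsBilateralGammaProcess 𝓕 Q (fun t ω => -X t ω) αm ℓm αp ℓp := by
  refine ⟨hX.1.neg, ?_⟩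
  rw [← map_neg_bilateralGammaMeasure hαp hℓp hαm hℓm, ← hX.2,
    Measure.map_map (by fun_prop) (hX.1.measurable 1)]
  rfl

end Negation

/-! ### Almost sure finiteness of the variation -/

section StepVariation

variable {Ω : Type*} {mΩ : MeasurableSpace Ω} {P : Measure Ω} [IsProbabilityMeasure P]
  {𝓕 : Filtration ℝ≥0 mΩ} {X : ℝ≥0 → Ω → ℝ} {αp ℓp αm ℓm : ℝ}

/-- Since `Z > 0`, the positive part of `Y - Z` is at most `Y`. -/
lemma lintegral_ofReal_bilateralGammaMeasure_le (hαp : 0 < αp) (hℓp : 0 < ℓp) (hαm : 0 < αm)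
    (hℓm : 0 < ℓm) :
    ∫⁻ x, ENNReal.ofReal x ∂bilateralGammaMeasure αp ℓp αm ℓm ≤ ENNReal.ofReal (αp / ℓp) := by
  have := isProbabilityMeasure_gammaMeasure hαp hℓp
  have := isProbabilityMeasure_gammaMeasure hαm hℓm
  rw [bilateralGammaMeasure, lintegral_map (by fun_prop) (by fun_prop),
    lintegral_prod _ (by fun_prop), ← lintegral_id_gammaMeasure hαp hℓp]
  refine lintegral_mono fun y => ?_
  calc _ ≤ ∫⁻ _, ENNReal.ofReal y ∂gammaMeasure αm ℓm := by
        refine lintegral_mono_ae ((ae_gammaMeasure_pos αm ℓm).mono fun z hz => ?_)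
        exact ENNReal.ofReal_le_ofReal (by linarith)
    _ = _ := by simp

/-- The mean bound for one step is linear in its length, so the total does not depend on the number
of steps. -/
lemma lintegral_stepVariation_le (hX : IsBilateralGammaProcess 𝓕 (fun _ => P) X αp ℓp αm ℓm)
    (hαp : 0 < αp) (hℓp : 0 < ℓp) (hαm : 0 < αm) (hℓm : 0 < ℓm) (t : ℝ≥0) (ht : 0 < t) (n : ℕ) :
    ∫⁻ ω, stepVariation (fun u => X u ω) 0 t (n + 1) ∂P ≤ ENNReal.ofReal (αp * t / ℓp) := by
  have hmeas := hX.1.measurable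
  set h : ℝ≥0 := (t - 0) / (n + 1 : ℕ) with hh
  have hpos : 0 < h := by rw [hh, tsub_zero]; positivity
  have hhr : (h : ℝ) = t / (n + 1 : ℕ) := by rw [hh, tsub_zero]; simp
  have hposr : (0 : ℝ) < h := hpos
  unfold stepVariation
  rw [lintegral_finsetSum _ fun i _ => by fun_prop]
  calc _ ≤ ∑ i ∈ Finset.range (n + 1), ENNReal.ofReal (αp * h / ℓp) := by
        refine Finset.sum_le_sum fun i _ => ?_
        rw [← hh, show (0 : ℝ≥0) + (i + 1 : ℕ) * h = (0 + i * h) + h by push_cast; ring,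
          ← lintegral_map (f := ENNReal.ofReal)
            (g := fun ω => X (0 + i * h + h) ω - X (0 + i * h) ω)
            (by fun_prop) (by fun_prop), hX.1.stationary, hX.map_eq hαp hℓp hαm hℓm hpos]
        exact lintegral_ofReal_bilateralGammaMeasure_le (by positivity) hℓp (by positivity) hℓm
    _ = _ := by
        rw [Finset.sum_const, Finset.card_range, nsmul_eq_mul, ← ENNReal.ofReal_natCast,
          ← ENNReal.ofReal_mul (by positivity), hhr]
        congr 1
        have : ((n + 1 : ℕ) : ℝ) ≠ 0 := by positivity
        field_simp

lemma measurable_stepVariation {m : MeasurableSpace Ω} {s t : ℝ≥0} (hst : s ≤ t)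
    (hX : ∀ u ≤ t, Measurable (X u)) (n : ℕ) :
    Measurable fun ω => stepVariation (fun u => X u ω) s t n := by
  unfold stepVariation
  have hle (i : ℕ) (hi : i ≤ n) : s + i * ((t - s) / n) ≤ t := by
    rcases Nat.eq_zero_or_pos n with rfl | hn
    · simpa using hst
    calc s + i * ((t - s) / n) ≤ s + n * ((t - s) / n) := by gcongr
      _ = t := by
        rw [mul_div_cancel₀ _ (by exact_mod_cast hn.ne'), add_tsub_cancel_of_le hst]
  refine Finset.measurable_fun_sum _ fun i hi => ?_
  have hi' := Finset.mem_range.mp hi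
  exact ((hX _ (hle (i + 1) hi')).sub (hX _ (hle i hi'.le))).ennreal_ofReal

lemma measurable_positiveVariation {m : MeasurableSpace Ω} {t : ℝ≥0}
    (hX : ∀ u ≤ t, Measurable (X u))
    (hrc : ∀ ω t, ContinuousWithinAt (fun s => X s ω) (Set.Ici t) t) :
    Measurable fun ω => positiveVariation (fun u => X u ω) t :=
  measurable_of_tendsto_metrizable
    (fun n : ℕ => measurable_stepVariation zero_le hX (n + 1))
    (tendsto_pi_nhds.mpr fun ω => tendsto_stepVariation_zero (hrc ω) t)

/-- Fatou's lemma carries the uniform mean bound to the limit. Monotonicity in time reduces all `t`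
to countably many integers, so one null set suffices. -/
lemma IsBilateralGammaProcess.ae_positiveVariation_ne_top
    (hX : IsBilateralGammaProcess 𝓕 (fun _ => P) X αp ℓp αm ℓm)
    (hαp : 0 < αp) (hℓp : 0 < ℓp) (hαm : 0 < αm) (hℓm : 0 < ℓm) :
    ∀ᵐ ω ∂P, ∀ t, positiveVariation (fun u => X u ω) t ≠ ⊤ := by
  have hmeas := hX.1.measurable
  have h1 (n : ℕ) : ∀ᵐ ω ∂P, positiveVariation (fun u => X u ω) (n + 1 : ℕ) < ⊤ := by
    have hm : Measurable fun ω => positiveVariation (fun u => X u ω) (n + 1 : ℕ) :=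
      measurable_positiveVariation (fun u _ => hmeas u) hX.1.right_continuous
    refine ae_lt_top hm (ne_top_of_le_ne_top
      (ENNReal.ofReal_ne_top (r := αp * ((n + 1 : ℕ) : ℝ≥0) / ℓp)) ?_)
    calc _ = ∫⁻ ω, liminf (fun k =>
            stepVariation (fun u => X u ω) 0 (n + 1 : ℕ) (k + 1)) atTop ∂P :=
          lintegral_congr fun ω =>
            (tendsto_stepVariation_zero (hX.1.right_continuous ω) _).liminf_eq.symm
      _ ≤ liminf (fun k => ∫⁻ ω, stepVariation (fun u => X u ω) 0 (n + 1 : ℕ) (k + 1) ∂P) atTop :=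
          lintegral_liminf_le fun k => measurable_stepVariation zero_le (fun u _ => hmeas u) _
      _ ≤ _ := by
          refine liminf_le_of_le (by isBoundedDefault) fun b hb => ?_
          obtain ⟨k, hk⟩ := hb.exists
          exact hk.trans (lintegral_stepVariation_le hX hαp hℓp hαm hℓm _ (by positivity) k)
  filter_upwards [ae_all_iff.mpr h1] with ω hω t
  refine ne_top_of_le_ne_top (hω ⌊t⌋₊).ne (positiveVariation_mono _ ?_)
  exact_mod_cast (Nat.lt_floor_add_one t).le

end StepVariation

/-! ### Products over independent increments -/

section Increments

variable {Ω : Type*} {mΩ : MeasurableSpace Ω} {P : Measure Ω}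
  {𝓕 : Filtration ℝ≥0 mΩ} {X : ℝ≥0 → Ω → ℝ}

/-- The last increment is independent of `𝓕 (s + n * h)`, which contains `A` and all earlier
factors. Keeping a set `A` from the past in the identity lets independence pass to the limit later
on. -/
lemma IsLevyProcess.setIntegral_prod_increments (hX : IsLevyProcess 𝓕 (fun _ => P) X) {F : ℝ → ℂ}
    (hF : Measurable F) (s h : ℝ≥0) {A : Set Ω} (hA : MeasurableSet[𝓕 s] A) (n : ℕ) :
    ∫ ω in A, ∏ i ∈ Finset.range n, F (X (s + (i + 1 : ℕ) * h) ω - X (s + i * h) ω) ∂P =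
      P.real A * (∫ x, F x ∂(P.map (X h))) ^ n := by
  have hmeas := hX.measurable
  have hAm : MeasurableSet A := 𝓕.le s A hA
  induction n with
  | zero => simp [Measure.real]
  | succ n ih =>
    have hsplit : ∫ ω in A, ∏ i ∈ Finset.range (n + 1),
        F (X (s + (i + 1 : ℕ) * h) ω - X (s + i * h) ω) ∂P =
        ∫ ω, (A.indicator (fun ω => ∏ i ∈ Finset.range n,
          F (X (s + (i + 1 : ℕ) * h) ω - X (s + i * h) ω)) ω) *
            F (X (s + (n + 1 : ℕ) * h) ω - X (s + n * h) ω) ∂P := by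
      rw [← integral_indicator hAm]
      refine integral_congr_ae (ae_of_all _ fun ω => ?_)
      by_cases hω : ω ∈ A <;> simp [hω, Finset.prod_range_succ]
    have hU : Measurable[𝓕 (s + n * h)] (A.indicator (fun ω => ∏ i ∈ Finset.range n,
          F (X (s + (i + 1 : ℕ) * h) ω - X (s + i * h) ω))) := by
      refine Measurable.indicator (m := 𝓕 (s + n * h)) ?_ (𝓕.mono le_self_add A hA)
      refine Finset.measurable_fun_prod _ fun i hi => hF.comp ?_
      have hi' := Finset.mem_range.mp hi
      have e1 : s + (i + 1 : ℕ) * h ≤ s + n * h := by gcongr; omega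
      have e2 : s + i * h ≤ s + n * h := by gcongr
      exact Measurable.sub ((hX.adapted _).mono (𝓕.mono e1) le_rfl)
        ((hX.adapted _).mono (𝓕.mono e2) le_rfl)
    have hle : s + n * h ≤ s + (n + 1 : ℕ) * h := by gcongr; exact n.le_succ
    have hind : IndepFun (A.indicator (fun ω => ∏ i ∈ Finset.range n,
          F (X (s + (i + 1 : ℕ) * h) ω - X (s + i * h) ω)))
        (fun ω => F (X (s + (n + 1 : ℕ) * h) ω - X (s + n * h) ω)) P := by
      refine indep_of_indep_of_le_left (indep_of_indep_of_le_right (hX.indep _ _ hle) ?_)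
        hU.comap_le
      exact (hF.comp (comap_measurable _)).comap_le
    rw [hsplit, hind.integral_fun_mul_eq_mul_integral
      (hU.mono (𝓕.le _) le_rfl).aestronglyMeasurable
      (hF.comp (by fun_prop)).aestronglyMeasurable, integral_indicator hAm, ih,
      ← integral_map (φ := fun ω => X (s + (n + 1 : ℕ) * h) ω - X (s + n * h) ω) (f := F)
        (by fun_prop) hF.aestronglyMeasurable,
      show s + ((n + 1 : ℕ) : ℝ≥0) * h = (s + n * h) + h by push_cast; ring, hX.stationary,
      pow_succ, mul_assoc]

end Increments

/-! ### Positive and negative parts over short time steps -/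

section Estimates

lemma norm_pow_sub_pow_le_of_norm_le_one {a b : ℂ} (ha : ‖a‖ ≤ 1) (hb : ‖b‖ ≤ 1) (n : ℕ) :
    ‖a ^ n - b ^ n‖ ≤ n * ‖a - b‖ := by
  induction n with
  | zero => simp
  | succ n ih =>
    calc ‖a ^ (n + 1) - b ^ (n + 1)‖ = ‖a ^ n * (a - b) + (a ^ n - b ^ n) * b‖ := by ring_nf
      _ ≤ ‖a‖ ^ n * ‖a - b‖ + ‖a ^ n - b ^ n‖ * ‖b‖ := by
        rw [← norm_pow, ← norm_mul, ← norm_mul]; exact norm_add_le _ _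
      _ ≤ 1 * ‖a - b‖ + (n * ‖a - b‖) * 1 := by
        gcongr
        exact pow_le_one₀ (norm_nonneg _) ha
      _ = _ := by push_cast; ring

/-- The expectation of the square root of a Gamma distributed random variable. -/
noncomputable def gammaSqrtMean (a r : ℝ) : ℝ := Real.Gamma (a + 1 / 2) / (Real.Gamma a * √r)

lemma integrable_sqrt_gammaMeasure {a r : ℝ} (ha : 0 < a) (hr : 0 < r) :
    Integrable (fun x => √x) (gammaMeasure a r) := by
  refine ⟨by fun_prop, ?_⟩
  rw [hasFiniteIntegral_iff_ofReal (ae_of_all _ fun x => Real.sqrt_nonneg x)]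
  simp_rw [Real.sqrt_eq_rpow]
  rw [lintegral_rpow_gammaMeasure ha hr (by norm_num)]
  exact ENNReal.ofReal_lt_top

lemma integral_sqrt_gammaMeasure {a r : ℝ} (ha : 0 < a) (hr : 0 < r) :
    ∫ x, √x ∂gammaMeasure a r = gammaSqrtMean a r := by
  have h1 := Real.Gamma_pos_of_pos ha
  have h2 := Real.Gamma_pos_of_pos (by positivity : 0 < a + 1 / 2)
  rw [integral_eq_lintegral_of_nonneg_ae (ae_of_all _ fun x => Real.sqrt_nonneg x) (by fun_prop),
    gammaSqrtMean]
  simp_rw [Real.sqrt_eq_rpow]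
  rw [lintegral_rpow_gammaMeasure ha hr (by norm_num), ENNReal.toReal_ofReal (by positivity)]

/-- By `Γ(b + 1) = b Γ(b)`, the mean of the square root vanishes linearly in the shape `b`, so it is
`O(1/n)` for shape `a / n`. -/
lemma tendsto_mul_gammaSqrtMean {a r : ℝ} (ha : 0 < a) :
    Tendsto (fun n : ℕ => (n + 1 : ℕ) * gammaSqrtMean (a / (n + 1 : ℕ)) r) atTop
      (𝓝 (a * (Real.Gamma (0 + 1 / 2) / (Real.Gamma (0 + 1) * √r)))) := by
  have hc : ContinuousAt (fun b : ℝ =>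
      a * (Real.Gamma (b + 1 / 2) / (Real.Gamma (b + 1) * √r))) 0 := by
    -- The sign of `r` is not restricted here; if `√r = 0`, division by zero makes the function
    -- identically zero.
    rcases eq_or_ne (√r) 0 with h | h
    · simp only [h, mul_zero, div_zero]
      exact continuousAt_const
    refine continuousAt_const.mul (ContinuousAt.div ?_ (ContinuousAt.mul ?_ continuousAt_const) ?_)
    · exact ContinuousAt.comp (f := fun b : ℝ => b + 1 / 2) (x := (0 : ℝ))
        (Real.differentiableAt_Gamma fun m h => by
          have : (0 : ℝ) ≤ m := m.cast_nonneg
          linarith).continuousAt (by fun_prop)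
    · exact ContinuousAt.comp (f := fun b : ℝ => b + 1) (x := (0 : ℝ))
        (Real.differentiableAt_Gamma fun m h => by
          have : (0 : ℝ) ≤ m := m.cast_nonneg
          linarith).continuousAt (by fun_prop)
    · simp [h]
  have hlim : Tendsto (fun n : ℕ => a / (n + 1 : ℕ)) atTop (𝓝 0) :=
    (tendsto_const_div_atTop_nhds_zero_nat a).comp (tendsto_add_atTop_nat 1)
  refine (hc.tendsto.comp hlim).congr fun n => ?_
  have hn : (0 : ℝ) < (n + 1 : ℕ) := by positivity
  have hpos : 0 < a / (n + 1 : ℕ) := by positivity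
  have hG := Real.Gamma_pos_of_pos hpos
  simp only [Function.comp_apply, gammaSqrtMean]
  rw [Real.Gamma_add_one hpos.ne']
  field_simp

lemma min_le_sqrt_mul_sqrt {y z : ℝ} (hy : 0 ≤ y) (hz : 0 ≤ z) : min y z ≤ √y * √z := by
  rw [← Real.sqrt_mul hy]
  refine Real.le_sqrt_of_sq_le ?_
  rw [sq]
  exact mul_le_mul (min_le_left _ _) (min_le_right _ _) (le_min hy hz) hy

/-- The characteristic function of the pair of the positive and the negative part of a bilateral
Gamma distributed random variable, compared with that of the pair of independent Gamma
distributed random variables of which it is the difference. -/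
lemma norm_integral_bilateralGammaMeasure_sub_le {αp ℓp αm ℓm : ℝ} (hαp : 0 < αp) (hℓp : 0 < ℓp)
    (hαm : 0 < αm) (hℓm : 0 < ℓm) (u v : ℝ) :
    ‖∫ x : ℝ, Complex.exp ((u * max x 0 + v * max (-x) 0 : ℝ) * Complex.I)
        ∂bilateralGammaMeasure αp ℓp αm ℓm -
      charFun (gammaMeasure αp ℓp) u * charFun (gammaMeasure αm ℓm) v‖ ≤
      (|u| + |v|) * (gammaSqrtMean αp ℓp * gammaSqrtMean αm ℓm) := by
  have := isProbabilityMeasure_gammaMeasure hαp hℓp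
  have := isProbabilityMeasure_gammaMeasure hαm hℓm
  rw [bilateralGammaMeasure, integral_map (by fun_prop) (by fun_prop), charFun_apply_real,
    charFun_apply_real, ← integral_prod_mul, ← integral_sub]
  · rw [← integral_sqrt_gammaMeasure hαp hℓp, ← integral_sqrt_gammaMeasure hαm hℓm,
      ← integral_prod_mul, ← integral_const_mul]
    refine norm_integral_le_of_norm_le (((integrable_sqrt_gammaMeasure hαp hℓp).mul_prod
      (integrable_sqrt_gammaMeasure hαm hℓm)).const_mul _) ?_
    have h1 : ∀ᵐ z ∂(gammaMeasure αp ℓp).prod (gammaMeasure αm ℓm), 0 < z.1 :=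
      Measure.quasiMeasurePreserving_fst.ae (ae_gammaMeasure_pos αp ℓp)
    have h2 : ∀ᵐ z ∂(gammaMeasure αp ℓp).prod (gammaMeasure αm ℓm), 0 < z.2 :=
      Measure.quasiMeasurePreserving_snd.ae (ae_gammaMeasure_pos αm ℓm)
    filter_upwards [h1, h2] with z hz1 hz2
    have e : Complex.exp (u * z.1 * Complex.I) * Complex.exp (v * z.2 * Complex.I) =
        Complex.exp ((u * z.1 + v * z.2 : ℝ) * Complex.I) := by
      rw [← Complex.exp_add]
      push_cast
      ring_nf
    rw [e]
    refine (norm_exp_mul_I_sub_exp_mul_I_le _ _).trans ?_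
    -- Both parts of `Y - Z` fall short of `Y` and `Z` by the same amount `min Y Z`. Bounding it by
    -- `√Y √Z` makes its mean factorise under the product measure.
    have e1 : max (z.1 - z.2) 0 - z.1 = -min z.1 z.2 := by
      rcases le_total z.1 z.2 with h | h
      · rw [max_eq_right (by linarith), min_eq_left h]; ring
      · rw [max_eq_left (by linarith), min_eq_right h]; ring
    have e2 : max (-(z.1 - z.2)) 0 - z.2 = -min z.1 z.2 := by
      rcases le_total z.1 z.2 with h | h
      · rw [max_eq_left (by linarith), min_eq_left h]; ring
      · rw [max_eq_right (by linarith), min_eq_right h]; ring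
    have hmin : 0 ≤ min z.1 z.2 := le_min hz1.le hz2.le
    calc |u * max (z.1 - z.2) 0 + v * max (-(z.1 - z.2)) 0 - (u * z.1 + v * z.2)|
        = |u * (max (z.1 - z.2) 0 - z.1) + v * (max (-(z.1 - z.2)) 0 - z.2)| := by ring_nf
      _ = |-(u + v)| * min z.1 z.2 := by
          rw [e1, e2, ← abs_of_nonneg hmin, ← abs_mul, abs_of_nonneg hmin]; ring_nf
      _ ≤ (|u| + |v|) * (√z.1 * √z.2) := by
          rw [abs_neg]
          gcongr
          · exact abs_add_le u v
          · exact min_le_sqrt_mul_sqrt hz1.le hz2.le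
  · exact Integrable.of_bound (by fun_prop) 1 (ae_of_all _ fun z => by
      rw [Complex.norm_exp_ofReal_mul_I])
  · refine Integrable.of_bound (by fun_prop) 1 (ae_of_all _ fun z => ?_)
    rw [norm_mul, ← Complex.ofReal_mul, ← Complex.ofReal_mul, Complex.norm_exp_ofReal_mul_I,
      Complex.norm_exp_ofReal_mul_I, one_mul]

/-- The error of one step is a product of two terms `O(1/n)`. Comparing powers of numbers in the
unit disc costs a factor `n + 1`, which leaves `O(1/n)`. -/
lemma tendsto_integral_bilateralGammaMeasure_pow {αp ℓp αm ℓm : ℝ} (hαp : 0 < αp) (hℓp : 0 < ℓp)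
    (hαm : 0 < αm) (hℓm : 0 < ℓm) (u v : ℝ) :
    Tendsto (fun n : ℕ => (∫ x : ℝ, Complex.exp ((u * max x 0 + v * max (-x) 0 : ℝ) * Complex.I)
        ∂bilateralGammaMeasure (αp / (n + 1 : ℕ)) ℓp (αm / (n + 1 : ℕ)) ℓm) ^ (n + 1)) atTop
      (𝓝 (charFun (gammaMeasure αp ℓp) u * charFun (gammaMeasure αm ℓm) v)) := by
  have hlim : Tendsto (fun n : ℕ => (|u| + |v|) * (((n + 1 : ℕ) : ℝ)⁻¹ *
      (((n + 1 : ℕ) * gammaSqrtMean (αp / (n + 1 : ℕ)) ℓp) *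
      ((n + 1 : ℕ) * gammaSqrtMean (αm / (n + 1 : ℕ)) ℓm)))) atTop (𝓝 0) := by
    have h0 : Tendsto (fun n : ℕ => ((n + 1 : ℕ) : ℝ)⁻¹) atTop (𝓝 0) :=
      tendsto_inv_atTop_nhds_zero_nat.comp (tendsto_add_atTop_nat 1)
    simpa using (h0.mul ((tendsto_mul_gammaSqrtMean (r := ℓp) hαp).mul
      (tendsto_mul_gammaSqrtMean (r := ℓm) hαm))).const_mul (|u| + |v|)
  rw [tendsto_iff_norm_sub_tendsto_zero]
  refine squeeze_zero (fun _ => norm_nonneg _) (fun n => ?_) hlim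
  have hn : (0 : ℝ) < (n + 1 : ℕ) := by positivity
  have hp : 0 < αp / (n + 1 : ℕ) := by positivity
  have hm : 0 < αm / (n + 1 : ℕ) := by positivity
  have := isProbabilityMeasure_gammaMeasure hp hℓp
  have := isProbabilityMeasure_gammaMeasure hm hℓm
  have := isProbabilityMeasure_bilateralGammaMeasure hp hℓp hm hℓm
  have e1 := charFun_gammaMeasure_nat_mul hp hℓp u n.succ_ne_zero
  have e2 := charFun_gammaMeasure_nat_mul hm hℓm v n.succ_ne_zero
  rw [Nat.succ_eq_add_one, mul_div_cancel₀ _ hn.ne'] at e1 e2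
  rw [e1, e2, ← mul_pow]
  refine (norm_pow_sub_pow_le_of_norm_le_one ?_ ?_ _).trans ?_
  · refine (norm_integral_le_of_norm_le_const (C := 1) (ae_of_all _ fun x => ?_)).trans
      (by rw [probReal_univ, mul_one])
    rw [Complex.norm_exp_ofReal_mul_I]
  · rw [norm_mul]
    exact mul_le_one₀ (norm_charFun_le_one _) (norm_nonneg _) (norm_charFun_le_one _)
  · calc _ ≤ ((n + 1 : ℕ) : ℝ) * ((|u| + |v|) * (gammaSqrtMean (αp / (n + 1 : ℕ)) ℓp *
          gammaSqrtMean (αm / (n + 1 : ℕ)) ℓm)) := by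
          gcongr
          exact norm_integral_bilateralGammaMeasure_sub_le hp hℓp hm hℓm u v
      _ = _ := by field_simp

end Estimates

/-! ### Independent Gamma increments of `(X⁺, X⁻)` -/

section JointLaw

variable {Ω : Type*} {mΩ : MeasurableSpace Ω}

/-- The increment of the pair `(X⁺, X⁻)` over the interval `[s, t]`. -/
noncomputable def partIncrement (X : ℝ≥0 → Ω → ℝ) (s t : ℝ≥0) (ω : Ω) : ℝ × ℝ :=
  (plusPart X t ω - plusPart X s ω, minusPart X t ω - minusPart X s ω)

variable {P : Measure Ω} {𝓕 : Filtration ℝ≥0 mΩ} {Q : ℝ≥0 → Measure Ω} {X : ℝ≥0 → Ω → ℝ}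
  {αp ℓp αm ℓm : ℝ}

lemma IsLevyProcess.measurable_plusPart (hX : IsLevyProcess 𝓕 Q X) (t : ℝ≥0) :
    Measurable[𝓕 t] (plusPart X t) := by
  refine Measurable.ennreal_toReal ?_
  exact measurable_positiveVariation (fun u hu => (hX.adapted u).mono (𝓕.mono hu) le_rfl)
    hX.right_continuous

lemma IsLevyProcess.measurable_minusPart (hX : IsLevyProcess 𝓕 Q X) (t : ℝ≥0) :
    Measurable[𝓕 t] (minusPart X t) :=
  hX.neg.measurable_plusPart t

lemma IsLevyProcess.measurable_partIncrement (hX : IsLevyProcess 𝓕 Q X) {s t : ℝ≥0}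
    (hst : s ≤ t) : Measurable[𝓕 t] (partIncrement X s t) :=
  Measurable.prodMk
    ((hX.measurable_plusPart t).sub ((hX.measurable_plusPart s).mono (𝓕.mono hst) le_rfl))
    ((hX.measurable_minusPart t).sub ((hX.measurable_minusPart s).mono (𝓕.mono hst) le_rfl))

variable [IsProbabilityMeasure P]

lemma tendsto_toReal_stepVariation {x : ℝ≥0 → ℝ}
    (hx : ∀ t, ContinuousWithinAt x (Set.Ici t) t) {s t : ℝ≥0} (hst : s ≤ t)
    (hfin : ∀ t, positiveVariation x t ≠ ⊤) :
    Tendsto (fun n => (stepVariation x s t (n + 1)).toReal) atTop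
      (𝓝 ((positiveVariation x t).toReal - (positiveVariation x s).toReal)) := by
  rw [← ENNReal.toReal_sub_of_le (positiveVariation_mono x hst) (hfin t)]
  exact (ENNReal.tendsto_toReal (ENNReal.sub_ne_top (hfin t))).comp
    (tendsto_stepVariation hx hst (hfin s))

/-- For each partition the exponential is a product of one function evaluated at independent,
identically distributed increments. Both sides of that identity have limits, by dominated
convergence and by the short-step estimate. -/
lemma IsBilateralGammaProcess.setIntegral_exp_partIncrement
    (hX : IsBilateralGammaProcess 𝓕 (fun _ => P) X αp ℓp αm ℓm)
    (hαp : 0 < αp) (hℓp : 0 < ℓp) (hαm : 0 < αm) (hℓm : 0 < ℓm) {s t : ℝ≥0} (hst : s < t)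
    {A : Set Ω} (hA : MeasurableSet[𝓕 s] A) (u v : ℝ) :
    ∫ ω in A, Complex.exp ((u * (partIncrement X s t ω).1 + v * (partIncrement X s t ω).2 : ℝ) *
        Complex.I) ∂P =
      P.real A * (charFun (gammaMeasure (αp * (t - s)) ℓp) u *
        charFun (gammaMeasure (αm * (t - s)) ℓm) v) := by
  have hd : (0 : ℝ) < t - s := sub_pos.mpr hst
  have hmeas := hX.1.measurable
  have hV (n : ℕ) : Measurable fun ω => stepVariation (fun r => X r ω) s t n :=
    measurable_stepVariation hst.le (fun r _ => hmeas r) n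
  have hV' (n : ℕ) : Measurable fun ω => stepVariation (fun r => -X r ω) s t n :=
    measurable_stepVariation (X := fun r ω => -X r ω) hst.le (fun r _ => (hmeas r).neg) n
  have hl1 : Tendsto (fun n : ℕ => ∫ ω in A, Complex.exp
      ((u * (stepVariation (fun r => X r ω) s t (n + 1)).toReal +
        v * (stepVariation (fun r => -X r ω) s t (n + 1)).toReal : ℝ) * Complex.I) ∂P) atTop
      (𝓝 (∫ ω in A, Complex.exp ((u * (partIncrement X s t ω).1 +
        v * (partIncrement X s t ω).2 : ℝ) * Complex.I) ∂P)) := by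
    refine tendsto_integral_of_dominated_convergence (fun _ => 1) (fun n => ?_)
      (integrable_const _) (fun n => ae_of_all _ fun ω => ?_) (ae_restrict_of_ae ?_)
    · have h1 := (hV (n + 1)).ennreal_toReal
      have h2 := (hV' (n + 1)).ennreal_toReal
      fun_prop
    · rw [Complex.norm_exp_ofReal_mul_I]
    · filter_upwards [hX.ae_positiveVariation_ne_top hαp hℓp hαm hℓm,
        (hX.neg hαp hℓp hαm hℓm).ae_positiveVariation_ne_top hαm hℓm hαp hℓp] with ω h1 h2
      have a : Tendsto (fun n => (stepVariation (fun r => X r ω) s t (n + 1)).toReal) atTop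
          (𝓝 (partIncrement X s t ω).1) :=
        tendsto_toReal_stepVariation (hX.1.right_continuous ω) hst.le h1
      have b : Tendsto (fun n => (stepVariation (fun r => -X r ω) s t (n + 1)).toReal) atTop
          (𝓝 (partIncrement X s t ω).2) :=
        tendsto_toReal_stepVariation (hX.1.neg.right_continuous ω) hst.le h2
      exact ((((a.const_mul u).add (b.const_mul v)).ofReal).mul_const Complex.I).cexp
  have hl2 := (tendsto_integral_bilateralGammaMeasure_pow (mul_pos hαp hd) hℓp (mul_pos hαm hd) hℓm
    u v).const_mul (P.real A : ℂ)
  refine tendsto_nhds_unique hl1 (hl2.congr fun n => ?_)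
  set h : ℝ≥0 := (t - s) / (n + 1 : ℕ) with hh
  have hpos : 0 < h := div_pos (tsub_pos_of_lt hst) (by positivity)
  have hhr : (h : ℝ) = (t - s) / (n + 1 : ℕ) := by
    rw [hh, NNReal.coe_div, NNReal.coe_sub hst.le, NNReal.coe_natCast]
  have hFm : Measurable fun x : ℝ =>
    Complex.exp ((u * max x 0 + v * max (-x) 0 : ℝ) * Complex.I) := by fun_prop
  rw [mul_div_assoc, mul_div_assoc, ← hhr, ← hX.map_eq hαp hℓp hαm hℓm hpos,
    ← hX.1.setIntegral_prod_increments hFm s h hA (n + 1)]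
  refine integral_congr_ae (ae_of_all _ fun ω => ?_)
  simp only
  rw [← Complex.exp_sum, toReal_stepVariation, toReal_stepVariation, ← Finset.sum_mul,
    ← Complex.ofReal_sum, Finset.sum_add_distrib, ← Finset.mul_sum, ← Finset.mul_sum]
  simp only [← hh, neg_sub_neg, neg_sub]

/-- Every linear functional on `ℝ × ℝ` is a pairing with some `(u, v)`. Finite measures are allowed
because the lemma is applied to `P` restricted to an event. -/
lemma ext_of_integral_exp_prod {μ ν : Measure (ℝ × ℝ)} [IsFiniteMeasure μ] [IsFiniteMeasure ν]
    (h : ∀ u v : ℝ, ∫ y, Complex.exp ((u * y.1 + v * y.2 : ℝ) * Complex.I) ∂μ =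
      ∫ y, Complex.exp ((u * y.1 + v * y.2 : ℝ) * Complex.I) ∂ν) : μ = ν := by
  refine Measure.ext_of_charFunDual (funext fun L => ?_)
  have hL (y : ℝ × ℝ) : L y = L (1, 0) * y.1 + L (0, 1) * y.2 := by
    conv_lhs => rw [show y = y.1 • ((1, 0) : ℝ × ℝ) + y.2 • ((0, 1) : ℝ × ℝ) by ext <;> simp]
    rw [map_add, map_smul, map_smul, smul_eq_mul, smul_eq_mul]
    ring
  have hL' : (fun y => Complex.exp (L y * Complex.I)) = fun y : ℝ × ℝ =>
      Complex.exp ((L (1, 0) * y.1 + L (0, 1) * y.2 : ℝ) * Complex.I) := by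
    funext y
    rw [hL y]
  rw [charFunDual_apply, charFunDual_apply, hL']
  exact h _ _

/-- The pair `(X⁺, X⁻)` has independent increments, distributed as pairs of independent Gamma
random variables. -/
theorem IsBilateralGammaProcess.measure_inter_partIncrement
    (hX : IsBilateralGammaProcess 𝓕 (fun _ => P) X αp ℓp αm ℓm)
    (hαp : 0 < αp) (hℓp : 0 < ℓp) (hαm : 0 < αm) (hℓm : 0 < ℓm) {s t : ℝ≥0} (hst : s < t)
    {A : Set Ω} (hA : MeasurableSet[𝓕 s] A) {B : Set (ℝ × ℝ)} (hB : MeasurableSet B) :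
    P (A ∩ partIncrement X s t ⁻¹' B) = P A *
      ((gammaMeasure (αp * (t - s)) ℓp).prod (gammaMeasure (αm * (t - s)) ℓm)) B := by
  have hd : (0 : ℝ) < t - s := sub_pos.mpr hst
  have := isProbabilityMeasure_gammaMeasure (mul_pos hαp hd) hℓp
  have := isProbabilityMeasure_gammaMeasure (mul_pos hαm hd) hℓm
  have hD : Measurable (partIncrement X s t) :=
    (hX.1.measurable_partIncrement hst.le).mono (𝓕.le t) le_rfl
  have : IsFiniteMeasure (P A • (gammaMeasure (αp * (t - s)) ℓp).prod
      (gammaMeasure (αm * (t - s)) ℓm)) := Measure.smul_finite _ (measure_ne_top P A)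
  -- This single identity of finite measures contains the law of the increment (`A` the whole space)
  -- and its independence of `𝓕 s`.
  have key : (P.restrict A).map (partIncrement X s t) =
      P A • (gammaMeasure (αp * (t - s)) ℓp).prod (gammaMeasure (αm * (t - s)) ℓm) := by
    refine ext_of_integral_exp_prod fun u v => ?_
    rw [integral_map hD.aemeasurable (by fun_prop),
      hX.setIntegral_exp_partIncrement hαp hℓp hαm hℓm hst hA, integral_smul_measure,
      charFun_apply_real, charFun_apply_real, ← integral_prod_mul, Complex.real_smul]
    congr 1
    refine integral_congr_ae (ae_of_all _ fun y => ?_)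
    simp only
    rw [← Complex.exp_add]
    push_cast
    ring_nf
  have h := congrArg (fun μ => μ B) key
  simp only [Measure.smul_apply, smul_eq_mul] at h
  rw [← h, Measure.map_apply hD hB, Measure.restrict_apply (hD hB), Set.inter_comm]

lemma IsBilateralGammaProcess.map_partIncrement
    (hX : IsBilateralGammaProcess 𝓕 (fun _ => P) X αp ℓp αm ℓm)
    (hαp : 0 < αp) (hℓp : 0 < ℓp) (hαm : 0 < αm) (hℓm : 0 < ℓm) {s t : ℝ≥0} (hst : s < t) :
    P.map (partIncrement X s t) =
      (gammaMeasure (αp * (t - s)) ℓp).prod (gammaMeasure (αm * (t - s)) ℓm) := by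
  have hD : Measurable (partIncrement X s t) :=
    (hX.1.measurable_partIncrement hst.le).mono (𝓕.le t) le_rfl
  ext B hB
  have := hX.measure_inter_partIncrement hαp hℓp hαm hℓm hst .univ hB
  rw [Measure.map_apply hD hB]
  simpa using this

lemma IsBilateralGammaProcess.indep_partIncrement
    (hX : IsBilateralGammaProcess 𝓕 (fun _ => P) X αp ℓp αm ℓm)
    (hαp : 0 < αp) (hℓp : 0 < ℓp) (hαm : 0 < αm) (hℓm : 0 < ℓm) {s t : ℝ≥0} (hst : s < t) :
    Indep (𝓕 s) (MeasurableSpace.comap (partIncrement X s t) inferInstance) P := by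
  have hD : Measurable (partIncrement X s t) :=
    (hX.1.measurable_partIncrement hst.le).mono (𝓕.le t) le_rfl
  rw [Indep_iff]
  rintro A _ hA ⟨B, hB, rfl⟩
  rw [hX.measure_inter_partIncrement hαp hℓp hαm hℓm hst hA hB,
    ← hX.map_partIncrement hαp hℓp hαm hℓm hst, Measure.map_apply hD hB]

lemma IsBilateralGammaProcess.ae_eq_plusPart_sub_minusPart
    (hX : IsBilateralGammaProcess 𝓕 (fun _ => P) X αp ℓp αm ℓm)
    (hαp : 0 < αp) (hℓp : 0 < ℓp) (hαm : 0 < αm) (hℓm : 0 < ℓm) :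
    ∀ᵐ ω ∂P, ∀ t, X t ω = plusPart X t ω - minusPart X t ω := by
  filter_upwards [hX.ae_positiveVariation_ne_top hαp hℓp hαm hℓm,
    (hX.neg hαp hℓp hαm hℓm).ae_positiveVariation_ne_top hαm hℓm hαp hℓp, hX.1.zero]
    with ω h1 h2 h0 t
  have := toReal_positiveVariation_sub_neg (hX.1.right_continuous ω) (h1 t) (h2 t)
  rw [h0, sub_zero] at this
  exact this.symm

lemma plusPart_zero (X : ℝ≥0 → Ω → ℝ) (ω : Ω) : plusPart X 0 ω = 0 := by
  simp [plusPart]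

lemma minusPart_zero (X : ℝ≥0 → Ω → ℝ) (ω : Ω) : minusPart X 0 ω = 0 := by
  simp [minusPart]

lemma minusPart_nonneg (X : ℝ≥0 → Ω → ℝ) (t : ℝ≥0) (ω : Ω) : 0 ≤ minusPart X t ω :=
  ENNReal.toReal_nonneg

end JointLaw

/-- The exponentially tilted Gamma distribution. -/
lemma withDensity_exp_sub_gammaMeasure {a r θ : ℝ} (hr : 0 < r) (hθ : θ < r) :
    (gammaMeasure a r).withDensity
      (fun x => ENNReal.ofReal (Real.exp (θ * x - a * Real.log (r / (r - θ))))) =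
      gammaMeasure a (r - θ) := by
  have hpos : 0 < r / (r - θ) := div_pos hr (sub_pos.mpr hθ)
  have hpow : Real.exp (-(a * Real.log (r / (r - θ)))) * (r / (r - θ)) ^ a = 1 := by
    rw [Real.rpow_def_of_pos hpos, ← Real.exp_add, mul_comm a, neg_add_cancel, Real.exp_zero]
  have h : (fun x => ENNReal.ofReal (Real.exp (θ * x - a * Real.log (r / (r - θ))))) =
      ENNReal.ofReal (Real.exp (-(a * Real.log (r / (r - θ))))) •
        fun x => ENNReal.ofReal (Real.exp (θ * x)) := by
    ext x
    rw [Pi.smul_apply, smul_eq_mul, ← ENNReal.ofReal_mul (Real.exp_pos _).le, ← Real.exp_add]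
    ring_nf
  rw [h, withDensity_smul _ (by fun_prop), withDensity_exp_gammaMeasure hr hθ, smul_smul,
    ← ENNReal.ofReal_mul (Real.exp_pos _).le, hpow, ENNReal.ofReal_one, one_smul]

/-! ### The bilateral Esscher transform -/

section Esscher

variable {Ω : Type*} {mΩ : MeasurableSpace Ω}

/-- `X` is a bilateral Gamma process under `P` and `(θp, θm)` is an admissible pair of parameters
of the Esscher transform. -/
structure IsAdmissible (𝓕 : Filtration ℝ≥0 mΩ) (P : Measure Ω) (X : ℝ≥0 → Ω → ℝ)
    (αp ℓp αm ℓm θp θm : ℝ) : Prop where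
  process : IsBilateralGammaProcess 𝓕 (fun _ => P) X αp ℓp αm ℓm
  αp_pos : 0 < αp
  ℓp_pos : 0 < ℓp
  αm_pos : 0 < αm
  ℓm_pos : 0 < ℓm
  θp_lt : θp < ℓp
  θm_lt : θm < ℓm

variable {P : Measure Ω} {𝓕 : Filtration ℝ≥0 mΩ} {X : ℝ≥0 → Ω → ℝ} {αp ℓp αm ℓm θp θm : ℝ}

lemma IsLevyProcess.measurable_esscherLikelihood {Q : ℝ≥0 → Measure Ω}
    (hX : IsLevyProcess 𝓕 Q X) (P : Measure Ω) (θp θm : ℝ) (t : ℝ≥0) :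
    Measurable[𝓕 t] (esscherLikelihood P X θp θm t) := by
  have h1 := hX.measurable_plusPart t
  have h2 := hX.measurable_minusPart t
  exact ((h1.const_mul θp).sub_const _).exp.mul ((h2.const_mul θm).sub_const _).exp

lemma esscherLikelihood_pos (P : Measure Ω) (X : ℝ≥0 → Ω → ℝ) (θp θm : ℝ) (t : ℝ≥0) (ω : Ω) :
    0 < esscherLikelihood P X θp θm t ω :=
  mul_pos (Real.exp_pos _) (Real.exp_pos _)

lemma bilateralEsscher_zero (P : Measure Ω) (X : ℝ≥0 → Ω → ℝ) (θp θm : ℝ) :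
    bilateralEsscher P X θp θm 0 = P := by
  simp [bilateralEsscher, esscherLikelihood, plusPart_zero, minusPart_zero]

lemma measure_eq_of_trim_eq {μ ν : Measure Ω} {t : ℝ≥0}
    (hμ : μ.trim (𝓕.le t) = ν.trim (𝓕.le t)) {A : Set Ω} (hA : MeasurableSet[𝓕 t] A) :
    μ A = ν A := by
  rw [← trim_measurableSet_eq (𝓕.le t) hA, hμ, trim_measurableSet_eq (𝓕.le t) hA]

/-- The measure `μ` is known only on `𝓕 t`, so null sets of `P` transfer only for events of `𝓕 t`.
-/
lemma ae_of_trim_eq_bilateralEsscher {μ : Measure Ω} {t : ℝ≥0}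
    (hμ : μ.trim (𝓕.le t) = (bilateralEsscher P X θp θm t).trim (𝓕.le t))
    {p : Ω → Prop} (hp : MeasurableSet[𝓕 t] {ω | p ω}) (hP : ∀ᵐ ω ∂P, p ω) : ∀ᵐ ω ∂μ, p ω := by
  rw [ae_iff, show {ω | ¬p ω} = {ω | p ω}ᶜ from rfl, measure_eq_of_trim_eq hμ hp.compl]
  exact withDensity_absolutelyContinuous P _ hP

variable [IsProbabilityMeasure P]

lemma IsBilateralGammaProcess.map_plusPart_one
    (hX : IsBilateralGammaProcess 𝓕 (fun _ => P) X αp ℓp αm ℓm)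
    (hαp : 0 < αp) (hℓp : 0 < ℓp) (hαm : 0 < αm) (hℓm : 0 < ℓm) :
    P.map (plusPart X 1) = gammaMeasure αp ℓp := by
  have := isProbabilityMeasure_gammaMeasure hαm hℓm
  have h := hX.map_partIncrement hαp hℓp hαm hℓm zero_lt_one
  simp only [NNReal.coe_one, NNReal.coe_zero, sub_zero, mul_one] at h
  have hD : Measurable (partIncrement X 0 1) :=
    (hX.1.measurable_partIncrement zero_le_one).mono (𝓕.le 1) le_rfl
  have e : plusPart X 1 = Prod.fst ∘ partIncrement X 0 1 := by
    ext ω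
    simp [partIncrement, plusPart_zero]
  rw [e, ← Measure.map_map measurable_fst hD, h, Measure.map_fst_prod]
  simp

lemma IsBilateralGammaProcess.cgf_plusPart_one
    (hX : IsBilateralGammaProcess 𝓕 (fun _ => P) X αp ℓp αm ℓm)
    (hαp : 0 < αp) (hℓp : 0 < ℓp) (hαm : 0 < αm) (hℓm : 0 < ℓm) {θ : ℝ} (hθ : θ < ℓp) :
    cgf (plusPart X 1) P θ = αp * Real.log (ℓp / (ℓp - θ)) := by
  have hpos : 0 < ℓp / (ℓp - θ) := div_pos hℓp (sub_pos.mpr hθ)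
  have hm : Measurable (plusPart X 1) := (hX.1.measurable_plusPart 1).mono (𝓕.le 1) le_rfl
  rw [cgf, ← mgf_id_map hm.aemeasurable, hX.map_plusPart_one hαp hℓp hαm hℓm,
    mgf_id_eq_toReal_lintegral, lintegral_exp_gammaMeasure hαp hℓp hθ,
    ENNReal.toReal_ofReal (by positivity), Real.log_rpow hpos]

namespace IsAdmissible

lemma esscherLikelihood_eq (h : IsAdmissible 𝓕 P X αp ℓp αm ℓm θp θm) (t : ℝ≥0) (ω : Ω) :
    esscherLikelihood P X θp θm t ω =
      Real.exp (θp * plusPart X t ω - αp * Real.log (ℓp / (ℓp - θp)) * t) *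
        Real.exp (θm * minusPart X t ω - αm * Real.log (ℓm / (ℓm - θm)) * t) := by
  have h1 := h.process.cgf_plusPart_one h.αp_pos h.ℓp_pos h.αm_pos h.ℓm_pos h.θp_lt
  have h2 : cgf (minusPart X 1) P θm = αm * Real.log (ℓm / (ℓm - θm)) :=
    (h.process.neg h.αp_pos h.ℓp_pos h.αm_pos h.ℓm_pos).cgf_plusPart_one
      h.αm_pos h.ℓm_pos h.αp_pos h.ℓp_pos h.θm_lt
  rw [esscherLikelihood, h1, h2]

lemma ofReal_esscherLikelihood_eq_mul (h : IsAdmissible 𝓕 P X αp ℓp αm ℓm θp θm) (s t : ℝ≥0)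
    (ω : Ω) :
    ENNReal.ofReal (esscherLikelihood P X θp θm t ω) =
      ENNReal.ofReal (esscherLikelihood P X θp θm s ω) *
        (ENNReal.ofReal (Real.exp (θp * (partIncrement X s t ω).1 -
          αp * (t - s) * Real.log (ℓp / (ℓp - θp)))) *
        ENNReal.ofReal (Real.exp (θm * (partIncrement X s t ω).2 -
          αm * (t - s) * Real.log (ℓm / (ℓm - θm))))) := by
  rw [h.esscherLikelihood_eq, h.esscherLikelihood_eq, ← ENNReal.ofReal_mul (Real.exp_pos _).le,
    ← ENNReal.ofReal_mul (by positivity)]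
  congr 1
  simp only [← Real.exp_add, partIncrement]
  congr 1
  ring

/-- The density splits into an `𝓕 s`-measurable factor and a tilt `w` of the independent increment;
the tilt lowers each Gamma rate. The case where `B` is the whole plane is consistency of the family.
-/
lemma bilateralEsscher_inter_partIncrement (h : IsAdmissible 𝓕 P X αp ℓp αm ℓm θp θm)
    {s t : ℝ≥0} (hst : s < t) {A : Set Ω} (hA : MeasurableSet[𝓕 s] A) {B : Set (ℝ × ℝ)}
    (hB : MeasurableSet B) :
    bilateralEsscher P X θp θm t (A ∩ partIncrement X s t ⁻¹' B) =
      bilateralEsscher P X θp θm s A * ((gammaMeasure (αp * (t - s)) (ℓp - θp)).prod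
        (gammaMeasure (αm * (t - s)) (ℓm - θm))) B := by
  obtain ⟨hX, hαp, hℓp, hαm, hℓm, hθp, hθm⟩ := h
  have hd : (0 : ℝ) < t - s := sub_pos.mpr hst
  have := isProbabilityMeasure_gammaMeasure (mul_pos hαp hd) hℓp
  have := isProbabilityMeasure_gammaMeasure (mul_pos hαm hd) hℓm
  have hD : Measurable (partIncrement X s t) :=
    (hX.1.measurable_partIncrement hst.le).mono (𝓕.le t) le_rfl
  have hAm := 𝓕.le s A hA
  let w : ℝ × ℝ → ℝ≥0∞ := fun y =>
    ENNReal.ofReal (Real.exp (θp * y.1 - αp * (t - s) * Real.log (ℓp / (ℓp - θp)))) *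
      ENNReal.ofReal (Real.exp (θm * y.2 - αm * (t - s) * Real.log (ℓm / (ℓm - θm))))
  have hw : Measurable w := by fun_prop
  have hwd :
      ((gammaMeasure (αp * (t - s)) ℓp).prod (gammaMeasure (αm * (t - s)) ℓm)).withDensity w =
      (gammaMeasure (αp * (t - s)) (ℓp - θp)).prod (gammaMeasure (αm * (t - s)) (ℓm - θm)) := by
    rw [← withDensity_exp_sub_gammaMeasure hℓp hθp, ← withDensity_exp_sub_gammaMeasure hℓm hθm,
      prod_withDensity (by fun_prop) (by fun_prop)]
  have hadm : IsAdmissible 𝓕 P X αp ℓp αm ℓm θp θm := ⟨hX, hαp, hℓp, hαm, hℓm, hθp, hθm⟩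
  have hL := (hX.1.measurable_esscherLikelihood P θp θm s).ennreal_ofReal
  have hprod : (fun ω => (A ∩ partIncrement X s t ⁻¹' B).indicator
      (fun ω => ENNReal.ofReal (esscherLikelihood P X θp θm t ω)) ω) =
      fun ω => A.indicator (fun ω => ENNReal.ofReal (esscherLikelihood P X θp θm s ω)) ω *
        B.indicator w (partIncrement X s t ω) := by
    ext ω
    by_cases h1 : ω ∈ A
    · by_cases h2 : partIncrement X s t ω ∈ B
      · simp only [Set.indicator, Set.mem_inter_iff, h1, h2, Set.mem_preimage, and_self, if_true]
        exact hadm.ofReal_esscherLikelihood_eq_mul s t ω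
      · simp [h2]
    · simp [h1]
  have hmul := lintegral_mul_eq_lintegral_mul_lintegral_of_independent_measurableSpace
    (g := fun ω => B.indicator w (partIncrement X s t ω)) (𝓕.le s) hD.comap_le
    (hX.indep_partIncrement hαp hℓp hαm hℓm hst) (hL.indicator hA)
    ((hw.indicator hB).comp (comap_measurable _))
  rw [bilateralEsscher, withDensity_apply _ (hAm.inter (hD hB)), ← lintegral_indicator
    (hAm.inter (hD hB)), hprod, hmul, lintegral_indicator hAm, ← withDensity_apply _ hAm,
    ← lintegral_map (hw.indicator hB) hD,
    hX.map_partIncrement hαp hℓp hαm hℓm hst, lintegral_indicator hB, ← withDensity_apply _ hB,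
    hwd]
  rfl

lemma bilateralEsscher_apply_of_le (h : IsAdmissible 𝓕 P X αp ℓp αm ℓm θp θm) {s t : ℝ≥0}
    (hst : s ≤ t) {A : Set Ω} (hA : MeasurableSet[𝓕 s] A) :
    bilateralEsscher P X θp θm t A = bilateralEsscher P X θp θm s A := by
  rcases hst.eq_or_lt with rfl | hst
  · rfl
  have hd : (0 : ℝ) < t - s := sub_pos.mpr hst
  have := isProbabilityMeasure_gammaMeasure (mul_pos h.αp_pos hd) (sub_pos.mpr h.θp_lt)
  have := isProbabilityMeasure_gammaMeasure (mul_pos h.αm_pos hd) (sub_pos.mpr h.θm_lt)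
  have := h.bilateralEsscher_inter_partIncrement hst hA .univ
  simpa using this

/-- The bilateral Esscher transforms are locally equivalent probability measures. -/
theorem isLocallyEquivalentProbability (h : IsAdmissible 𝓕 P X αp ℓp αm ℓm θp θm) :
    IsLocallyEquivalentProbability 𝓕 P (bilateralEsscher P X θp θm) where
  isProbabilityMeasure t := ⟨by
    rw [h.bilateralEsscher_apply_of_le (zero_le (a := t)) .univ, bilateralEsscher_zero,
      measure_univ]⟩
  consistent s t hst := by
    refine @Measure.ext _ (𝓕 s) _ _ fun A hA => ?_
    rw [trim_measurableSet_eq _ hA, trim_measurableSet_eq _ hA,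
      h.bilateralEsscher_apply_of_le hst hA]
  absolutelyContinuous t := (withDensity_absolutelyContinuous P _).trim (𝓕.le t)
  absolutelyContinuous' t := by
    refine (withDensity_absolutelyContinuous' ?_ (ae_of_all _ fun ω => ?_)).trim (𝓕.le t)
    · have hm := (h.process.1.measurable_esscherLikelihood P θp θm t).mono (𝓕.le t) le_rfl
      exact hm.ennreal_ofReal.aemeasurable
    · simpa using esscherLikelihood_pos P X θp θm t ω

/-! ### Increments under any measure that agrees with the transform on `𝓕 t` -/

section Agreement

variable {μ : Measure Ω} {t : ℝ≥0}

lemma trim_eq_of_le (h : IsAdmissible 𝓕 P X αp ℓp αm ℓm θp θm)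
    (hμ : μ.trim (𝓕.le t) = (bilateralEsscher P X θp θm t).trim (𝓕.le t)) {s : ℝ≥0}
    (hst : s ≤ t) : μ.trim (𝓕.le s) = (bilateralEsscher P X θp θm s).trim (𝓕.le s) := by
  rw [← trim_trim (hm₁₂ := 𝓕.mono hst) (hm₂ := 𝓕.le t), hμ, trim_trim]
  exact h.isLocallyEquivalentProbability.consistent s t hst

lemma isProbabilityMeasure_of_trim_eq (h : IsAdmissible 𝓕 P X αp ℓp αm ℓm θp θm)
    (hμ : μ.trim (𝓕.le t) = (bilateralEsscher P X θp θm t).trim (𝓕.le t)) :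
    IsProbabilityMeasure μ := by
  have := h.isLocallyEquivalentProbability.isProbabilityMeasure t
  exact ⟨by rw [measure_eq_of_trim_eq hμ .univ, measure_univ]⟩

lemma measure_inter_partIncrement_of_trim_eq (h : IsAdmissible 𝓕 P X αp ℓp αm ℓm θp θm)
    (hμ : μ.trim (𝓕.le t) = (bilateralEsscher P X θp θm t).trim (𝓕.le t)) {s : ℝ≥0}
    (hst : s < t) {A : Set Ω} (hA : MeasurableSet[𝓕 s] A) {B : Set (ℝ × ℝ)}
    (hB : MeasurableSet B) :
    μ (A ∩ partIncrement X s t ⁻¹' B) = μ A * ((gammaMeasure (αp * (t - s)) (ℓp - θp)).prod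
        (gammaMeasure (αm * (t - s)) (ℓm - θm))) B := by
  rw [measure_eq_of_trim_eq hμ ((𝓕.mono hst.le A hA).inter
    (h.process.1.measurable_partIncrement hst.le hB)),
    measure_eq_of_trim_eq (h.trim_eq_of_le hμ hst.le) hA,
    h.bilateralEsscher_inter_partIncrement hst hA hB]

lemma map_partIncrement_of_trim_eq (h : IsAdmissible 𝓕 P X αp ℓp αm ℓm θp θm)
    (hμ : μ.trim (𝓕.le t) = (bilateralEsscher P X θp θm t).trim (𝓕.le t)) {s : ℝ≥0}
    (hst : s < t) : μ.map (partIncrement X s t) =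
      (gammaMeasure (αp * (t - s)) (ℓp - θp)).prod (gammaMeasure (αm * (t - s)) (ℓm - θm)) := by
  have := h.isProbabilityMeasure_of_trim_eq hμ
  have hD : Measurable (partIncrement X s t) :=
    (h.process.1.measurable_partIncrement hst.le).mono (𝓕.le t) le_rfl
  ext B hB
  rw [Measure.map_apply hD hB]
  simpa using h.measure_inter_partIncrement_of_trim_eq hμ hst .univ hB

lemma indep_partIncrement_of_trim_eq (h : IsAdmissible 𝓕 P X αp ℓp αm ℓm θp θm)
    (hμ : μ.trim (𝓕.le t) = (bilateralEsscher P X θp θm t).trim (𝓕.le t)) {s : ℝ≥0}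
    (hst : s < t) :
    Indep (𝓕 s) (MeasurableSpace.comap (partIncrement X s t) inferInstance) μ := by
  have hD : Measurable (partIncrement X s t) :=
    (h.process.1.measurable_partIncrement hst.le).mono (𝓕.le t) le_rfl
  rw [Indep_iff]
  rintro A _ hA ⟨B, hB, rfl⟩
  rw [h.measure_inter_partIncrement_of_trim_eq hμ hst hA hB,
    ← h.map_partIncrement_of_trim_eq hμ hst, Measure.map_apply hD hB]

lemma ae_sub_eq_partIncrement_of_trim_eq (h : IsAdmissible 𝓕 P X αp ℓp αm ℓm θp θm)
    (hμ : μ.trim (𝓕.le t) = (bilateralEsscher P X θp θm t).trim (𝓕.le t)) {s : ℝ≥0}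
    (hst : s ≤ t) :
    ∀ᵐ ω ∂μ, X t ω - X s ω = (partIncrement X s t ω).1 - (partIncrement X s t ω).2 := by
  have hD := h.process.1.measurable_partIncrement hst
  refine ae_of_trim_eq_bilateralEsscher hμ (measurableSet_eq_fun ?_ ?_) ?_
  · exact (h.process.1.adapted t).sub ((h.process.1.adapted s).mono (𝓕.mono hst) le_rfl)
  · exact (measurable_fst.comp hD).sub (measurable_snd.comp hD)
  · filter_upwards [h.process.ae_eq_plusPart_sub_minusPart h.αp_pos h.ℓp_pos h.αm_pos h.ℓm_pos]
      with ω hω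
    rw [hω t, hω s, partIncrement]
    ring

lemma map_sub_of_trim_eq (h : IsAdmissible 𝓕 P X αp ℓp αm ℓm θp θm)
    (hμ : μ.trim (𝓕.le t) = (bilateralEsscher P X θp θm t).trim (𝓕.le t)) {s : ℝ≥0}
    (hst : s < t) : μ.map (fun ω => X t ω - X s ω) =
      bilateralGammaMeasure (αp * (t - s)) (ℓp - θp) (αm * (t - s)) (ℓm - θm) := by
  have hD : Measurable (partIncrement X s t) :=
    (h.process.1.measurable_partIncrement hst.le).mono (𝓕.le t) le_rfl
  rw [Measure.map_congr (h.ae_sub_eq_partIncrement_of_trim_eq hμ hst.le), bilateralGammaMeasure,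
    ← h.map_partIncrement_of_trim_eq hμ hst, Measure.map_map (by fun_prop) hD]
  rfl

lemma indep_sub_of_trim_eq (h : IsAdmissible 𝓕 P X αp ℓp αm ℓm θp θm)
    (hμ : μ.trim (𝓕.le t) = (bilateralEsscher P X θp θm t).trim (𝓕.le t)) {s : ℝ≥0}
    (hst : s ≤ t) :
    Indep (𝓕 s) (MeasurableSpace.comap (fun ω => X t ω - X s ω) inferInstance) μ := by
  have := h.isProbabilityMeasure_of_trim_eq hμ
  rcases hst.eq_or_lt with rfl | hlt
  · simp only [sub_self, MeasurableSpace.comap_const]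
    exact indep_bot_right _
  have hD : Measurable[MeasurableSpace.comap (partIncrement X s t) inferInstance]
      (partIncrement X s t) := comap_measurable _
  have hind : Indep (𝓕 s) (MeasurableSpace.comap
      (fun ω => (partIncrement X s t ω).1 - (partIncrement X s t ω).2) inferInstance) μ := by
    refine indep_of_indep_of_le_right (h.indep_partIncrement_of_trim_eq hμ hlt) ?_
    exact Measurable.comap_le ((measurable_fst.comp hD).sub (measurable_snd.comp hD))
  have hae := h.ae_sub_eq_partIncrement_of_trim_eq hμ hst
  rw [Indep_iff] at hind ⊢
  rintro A _ hA ⟨B, hB, rfl⟩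
  -- The increment of `X` equals that of `X⁺ - X⁻` only almost surely, so independence is
  -- transferred event by event.
  have hset : (fun ω => X t ω - X s ω) ⁻¹' B =ᵐ[μ]
      (fun ω => (partIncrement X s t ω).1 - (partIncrement X s t ω).2) ⁻¹' B := by
    filter_upwards [hae] with ω hω
    exact congrArg B hω
  rw [measure_congr hset, measure_congr ((ae_eq_refl A).inter hset)]
  exact hind A _ hA ⟨B, hB, rfl⟩

lemma ae_zero_of_trim_eq (h : IsAdmissible 𝓕 P X αp ℓp αm ℓm θp θm)
    (hμ : μ.trim (𝓕.le t) = (bilateralEsscher P X θp θm t).trim (𝓕.le t)) :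
    ∀ᵐ ω ∂μ, X 0 ω = 0 :=
  ae_of_trim_eq_bilateralEsscher (h.trim_eq_of_le hμ zero_le)
    (measurableSet_eq_fun (h.process.1.adapted 0) measurable_const) h.process.1.zero

lemma map_of_trim_eq (h : IsAdmissible 𝓕 P X αp ℓp αm ℓm θp θm)
    (hμ : μ.trim (𝓕.le t) = (bilateralEsscher P X θp θm t).trim (𝓕.le t)) (ht : 0 < t) :
    μ.map (X t) = bilateralGammaMeasure (αp * t) (ℓp - θp) (αm * t) (ℓm - θm) := by
  have h0 : X t =ᵐ[μ] fun ω => X t ω - X 0 ω := by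
    filter_upwards [h.ae_zero_of_trim_eq hμ] with ω hω
    simp [hω]
  rw [Measure.map_congr h0, h.map_sub_of_trim_eq hμ ht]
  simp

end Agreement

/-- `X` is a bilateral Gamma process under the bilateral Esscher transforms. -/
theorem isBilateralGammaProcess_of_trim_eq (h : IsAdmissible 𝓕 P X αp ℓp αm ℓm θp θm)
    {Q : ℝ≥0 → Measure Ω}
    (hQ : ∀ t, (Q t).trim (𝓕.le t) = (bilateralEsscher P X θp θm t).trim (𝓕.le t)) :
    IsBilateralGammaProcess 𝓕 Q X αp (ℓp - θp) αm (ℓm - θm) where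
  left :=
    { adapted := h.process.1.adapted
      zero := h.ae_zero_of_trim_eq (hQ 0)
      right_continuous := h.process.1.right_continuous
      left_limits := h.process.1.left_limits
      indep := fun s t hst => h.indep_sub_of_trim_eq (hQ t) hst
      stationary := fun s t => by
        have h1 := h.isProbabilityMeasure_of_trim_eq (hQ (s + t))
        -- The marginal formula needs a positive shape. For `t = 0` both laws are the Dirac mass at
        -- `0`.
        rcases eq_zero_or_pos t with rfl | ht
        · have h2 := h.isProbabilityMeasure_of_trim_eq (hQ s)
          have h3 := h.isProbabilityMeasure_of_trim_eq (hQ 0)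
          rw [Measure.map_congr (h.ae_zero_of_trim_eq (hQ 0) : X 0 =ᵐ[Q 0] fun _ => (0 : ℝ))]
          simp
        · rw [h.map_sub_of_trim_eq (hQ (s + t)) (lt_add_of_pos_right s ht),
            h.map_of_trim_eq (hQ t) ht]
          simp }
  right := by
    rw [h.map_of_trim_eq (hQ 1) one_pos]
    simp

end IsAdmissible

end Esscher

/-! ### Exponential moments and the martingale condition -/

section MartingaleCondition

/-- The condition on the rates `ℓp`, `ℓm` of a bilateral Gamma process under which the discounted
price with drift rate `c` is a martingale. -/
def MartingaleCondition (c αp ℓp αm ℓm : ℝ) : Prop :=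
  1 < ℓp ∧ (ℓp / (ℓp - 1)) ^ αp * (ℓm / (ℓm + 1)) ^ αm = Real.exp c

lemma lintegral_exp_one_bilateralGammaMeasure {αp ℓp αm ℓm : ℝ} (hαp : 0 < αp) (hℓp : 1 < ℓp)
    (hαm : 0 < αm) (hℓm : 0 < ℓm) :
    ∫⁻ x, ENNReal.ofReal (Real.exp x) ∂bilateralGammaMeasure αp ℓp αm ℓm =
      ENNReal.ofReal ((ℓp / (ℓp - 1)) ^ αp * (ℓm / (ℓm + 1)) ^ αm) := by
  have h := lintegral_exp_bilateralGammaMeasure hαp (zero_lt_one.trans hℓp) hαm hℓm 1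
  have h1 : 0 < ℓp / (ℓp - 1) := div_pos (by linarith) (by linarith)
  rw [lintegral_exp_gammaMeasure hαp (by linarith) hℓp,
    lintegral_exp_gammaMeasure hαm hℓm (by linarith : -1 < ℓm), sub_neg_eq_add,
    ← ENNReal.ofReal_mul (by positivity)] at h
  simpa only [one_mul] using h

/-- For `ℓp ≤ 1` the positive Gamma factor of the moment is infinite, and the other factor cannot
compensate because it is positive. -/
lemma one_lt_of_lintegral_exp_bilateralGammaMeasure_lt_top {αp ℓp αm ℓm : ℝ} (hαp : 0 < αp)
    (hℓp : 0 < ℓp) (hαm : 0 < αm) (hℓm : 0 < ℓm)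
    (h : ∫⁻ x, ENNReal.ofReal (Real.exp x) ∂bilateralGammaMeasure αp ℓp αm ℓm < ⊤) : 1 < ℓp := by
  by_contra! hle
  have h1 := lintegral_exp_bilateralGammaMeasure hαp hℓp hαm hℓm 1
  have hpos : 0 < (ℓm / (ℓm - -1)) ^ αm :=
    Real.rpow_pos_of_pos (div_pos hℓm (by linarith)) _
  rw [lintegral_exp_gammaMeasure_eq_top hαp hℓp hle,
    lintegral_exp_gammaMeasure hαm hℓm (by linarith : -1 < ℓm),
    ENNReal.top_mul (by simpa using hpos)] at h1
  simp only [one_mul] at h1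
  exact h.ne h1

/-- The shapes are proportional to time, so this is the time-one identity raised to the power `τ`.
-/
lemma MartingaleCondition.lintegral_exp {c αp ℓp αm ℓm τ : ℝ}
    (hC : MartingaleCondition c αp ℓp αm ℓm) (hαp : 0 < αp) (hαm : 0 < αm) (hℓm : 0 < ℓm)
    (hτ : 0 < τ) :
    ∫⁻ x, ENNReal.ofReal (Real.exp x) ∂bilateralGammaMeasure (αp * τ) ℓp (αm * τ) ℓm =
      ENNReal.ofReal (Real.exp (c * τ)) := by
  have h1 : 0 < ℓp / (ℓp - 1) := div_pos (by linarith [hC.1]) (by linarith [hC.1])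
  have h2 : 0 < ℓm / (ℓm + 1) := by positivity
  rw [lintegral_exp_one_bilateralGammaMeasure (mul_pos hαp hτ) hC.1 (mul_pos hαm hτ) hℓm,
    Real.rpow_mul h1.le, Real.rpow_mul h2.le, ← Real.mul_rpow (by positivity) (by positivity),
    hC.2, ← Real.exp_mul]

end MartingaleCondition

/-! ### Characterisation of the martingale measures -/

section Martingale

variable {Ω : Type*} {mΩ : MeasurableSpace Ω} {P : Measure Ω} {𝓕 : Filtration ℝ≥0 mΩ}
  {X : ℝ≥0 → Ω → ℝ} {αp ℓp αm ℓm θp θm S₀ r q : ℝ}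

lemma IsLevyProcess.measurable_discountedPrice {Q : ℝ≥0 → Measure Ω} (hX : IsLevyProcess 𝓕 Q X)
    (S₀ r q : ℝ) (t : ℝ≥0) : Measurable[𝓕 t] (discountedPrice S₀ r q X t) :=
  (((hX.adapted t).sub_const _).exp).const_mul S₀

variable [IsProbabilityMeasure P]

namespace IsAdmissible

section Agreement

variable {μ : Measure Ω} {t : ℝ≥0}

lemma lintegral_exp_sub_of_trim_eq (h : IsAdmissible 𝓕 P X αp ℓp αm ℓm θp θm)
    (hμ : μ.trim (𝓕.le t) = (bilateralEsscher P X θp θm t).trim (𝓕.le t))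
    (hC : MartingaleCondition (r - q) αp (ℓp - θp) αm (ℓm - θm)) {s : ℝ≥0} (hst : s < t) :
    ∫⁻ ω, ENNReal.ofReal (Real.exp (X t ω - X s ω)) ∂μ =
      ENNReal.ofReal (Real.exp ((r - q) * (t - s))) := by
  have hmeas := h.process.1.measurable
  rw [← lintegral_map (f := fun x => ENNReal.ofReal (Real.exp x)) (g := fun ω => X t ω - X s ω)
    (by fun_prop) (by fun_prop), h.map_sub_of_trim_eq hμ hst]
  exact hC.lintegral_exp h.αp_pos h.αm_pos (sub_pos.mpr h.θm_lt) (sub_pos.mpr hst)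

lemma integrable_discountedPrice_of_trim_eq (h : IsAdmissible 𝓕 P X αp ℓp αm ℓm θp θm)
    (hμ : μ.trim (𝓕.le t) = (bilateralEsscher P X θp θm t).trim (𝓕.le t))
    (hC : MartingaleCondition (r - q) αp (ℓp - θp) αm (ℓm - θm)) :
    Integrable (discountedPrice S₀ r q X t) μ := by
  have := h.isProbabilityMeasure_of_trim_eq hμ
  have hmeas := h.process.1.measurable
  have h0 := h.ae_zero_of_trim_eq hμ
  rcases eq_zero_or_pos t with rfl | ht
  · refine (integrable_const S₀).congr ?_
    filter_upwards [h0] with ω hω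
    simp [discountedPrice, hω]
  have hint : Integrable (fun ω => Real.exp (X t ω - X 0 ω)) μ := by
    refine ⟨by fun_prop, ?_⟩
    rw [hasFiniteIntegral_iff_ofReal (ae_of_all _ fun ω => (Real.exp_pos _).le),
      h.lintegral_exp_sub_of_trim_eq hμ hC ht]
    exact ENNReal.ofReal_lt_top
  refine (hint.const_mul (S₀ * Real.exp (-((r - q) * t)))).congr ?_
  filter_upwards [h0] with ω hω
  rw [discountedPrice, hω, sub_zero, mul_assoc, ← Real.exp_add]
  ring_nf

/-- The price at `t` is the price at `s` times a factor `g` that is independent of `𝓕 s` and has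
mean one. -/
lemma condExp_discountedPrice_of_trim_eq (h : IsAdmissible 𝓕 P X αp ℓp αm ℓm θp θm)
    (hμ : μ.trim (𝓕.le t) = (bilateralEsscher P X θp θm t).trim (𝓕.le t))
    (hC : MartingaleCondition (r - q) αp (ℓp - θp) αm (ℓm - θm)) {s : ℝ≥0} (hst : s ≤ t) :
    μ[discountedPrice S₀ r q X t | 𝓕 s] =ᵐ[μ] discountedPrice S₀ r q X s := by
  have := h.isProbabilityMeasure_of_trim_eq hμ
  have hint := h.integrable_discountedPrice_of_trim_eq (S₀ := S₀) hμ hC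
  have hms := (h.process.1.measurable_discountedPrice S₀ r q s).stronglyMeasurable
  rcases hst.eq_or_lt with rfl | hst
  · rw [condExp_of_stronglyMeasurable (𝓕.le s) hms hint]
  have hmeas := h.process.1.measurable
  have hD : Measurable fun ω => X t ω - X s ω := by fun_prop
  set g : Ω → ℝ := fun ω => Real.exp ((X t ω - X s ω) - (r - q) * (t - s)) with hg
  have hlint := h.lintegral_exp_sub_of_trim_eq hμ hC hst
  have hexp : Integrable (fun ω => Real.exp (X t ω - X s ω)) μ := by
    refine ⟨by fun_prop, ?_⟩
    rw [hasFiniteIntegral_iff_ofReal (ae_of_all _ fun ω => (Real.exp_pos _).le), hlint]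
    exact ENNReal.ofReal_lt_top
  have hg' : g = fun ω => Real.exp (X t ω - X s ω) * Real.exp (-((r - q) * (t - s))) := by
    ext ω
    rw [hg, ← Real.exp_add]
    ring_nf
  have hgint : Integrable g μ := by
    rw [hg']
    exact hexp.mul_const _
  have hg1 : ∫ ω, g ω ∂μ = 1 := by
    rw [hg', integral_mul_const, integral_eq_lintegral_of_nonneg_ae
      (ae_of_all _ fun ω => (Real.exp_pos _).le) (by fun_prop), hlint,
      ENNReal.toReal_ofReal (Real.exp_pos _).le, ← Real.exp_add, add_neg_cancel, Real.exp_zero]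
  have hmul : discountedPrice S₀ r q X t = discountedPrice S₀ r q X s * g := by
    ext ω
    rw [Pi.mul_apply, discountedPrice, discountedPrice, hg, mul_assoc, ← Real.exp_add]
    ring_nf
  have hgm : StronglyMeasurable[MeasurableSpace.comap (fun ω => X t ω - X s ω) inferInstance] g :=
    Measurable.stronglyMeasurable (((comap_measurable _).sub_const _).exp)
  have hcond := condExp_indep_eq hD.comap_le (𝓕.le s) hgm
    (h.indep_sub_of_trim_eq hμ hst.le).symm
  have hpull := condExp_mul_of_stronglyMeasurable_left hms (hmul ▸ hint) hgint
  rw [hmul]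
  filter_upwards [hcond, hpull] with ω h1 h2
  rw [h2, Pi.mul_apply, h1, hg1, mul_one]

end Agreement

/-- Under the martingale condition the discounted price is a martingale under every measure with
the prescribed restrictions. -/
theorem martingale_discountedPrice (h : IsAdmissible 𝓕 P X αp ℓp αm ℓm θp θm) {Q : Measure Ω}
    (hQ : ∀ t, Q.trim (𝓕.le t) = (bilateralEsscher P X θp θm t).trim (𝓕.le t))
    (hC : MartingaleCondition (r - q) αp (ℓp - θp) αm (ℓm - θm)) :
    Martingale (discountedPrice S₀ r q X) 𝓕 Q :=
  ⟨fun t => (h.process.1.measurable_discountedPrice S₀ r q t).stronglyMeasurable,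
    fun _ t hst => h.condExp_discountedPrice_of_trim_eq (hQ t) hC hst⟩

lemma isLocalMartingale_of_martingaleCondition (h : IsAdmissible 𝓕 P X αp ℓp αm ℓm θp θm)
    (hC : MartingaleCondition (r - q) αp (ℓp - θp) αm (ℓm - θm)) :
    IsLocalMartingale 𝓕 (bilateralEsscher P X θp θm) (discountedPrice S₀ r q X) := by
  intro T
  have := h.isLocallyEquivalentProbability.isProbabilityMeasure T
  have hm (t : ℝ≥0) := (h.process.1.measurable_discountedPrice S₀ r q t).stronglyMeasurable
  refine Locally.of_prop ⟨fun t => (hm _).mono (𝓕.mono (min_le_left t T)), fun s t hst => ?_⟩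
  rcases le_total s T with hs | hs <;> simp only
  · rw [min_eq_left hs]
    exact h.condExp_discountedPrice_of_trim_eq (h.trim_eq_of_le rfl (min_le_right t T)) hC
      (le_min hst hs)
  -- After time `T` the stopped price no longer moves and is `𝓕 s`-measurable.
  · rw [min_eq_right hs, min_eq_right (hs.trans hst),
      condExp_of_stronglyMeasurable (𝓕.le s) ((hm T).mono (𝓕.mono hs))
        (h.integrable_discountedPrice_of_trim_eq rfl hC)]

/-- Both `X⁻` and, because `q ≤ r`, the drift only lower the price, while `X⁺` is nondecreasing. One
random variable thus dominates the whole path on `[0, t]`, hence also all stopped prices. -/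
lemma ae_discountedPrice_le (h : IsAdmissible 𝓕 P X αp ℓp αm ℓm θp θm) (hS₀ : 0 < S₀)
    (hqr : q ≤ r) (t : ℝ≥0) :
    ∀ᵐ ω ∂P, ∀ s ≤ t, discountedPrice S₀ r q X s ω ≤ S₀ * Real.exp (plusPart X t ω) := by
  filter_upwards [h.process.ae_eq_plusPart_sub_minusPart h.αp_pos h.ℓp_pos h.αm_pos h.ℓm_pos,
    h.process.ae_positiveVariation_ne_top h.αp_pos h.ℓp_pos h.αm_pos h.ℓm_pos] with ω h1 h2 s hst
  have hmono : plusPart X s ω ≤ plusPart X t ω :=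
    ENNReal.toReal_mono (h2 t) (positiveVariation_mono _ hst)
  have hm := minusPart_nonneg X s ω
  have hd : 0 ≤ (r - q) * s := mul_nonneg (sub_nonneg.mpr hqr) s.2
  rw [discountedPrice, h1 s]
  gcongr
  linarith

lemma map_plusPart_one_bilateralEsscher (h : IsAdmissible 𝓕 P X αp ℓp αm ℓm θp θm) :
    (bilateralEsscher P X θp θm 1).map (plusPart X 1) = gammaMeasure αp (ℓp - θp) := by
  have := isProbabilityMeasure_gammaMeasure h.αm_pos (sub_pos.mpr h.θm_lt)
  have hD : Measurable (partIncrement X 0 1) :=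
    (h.process.1.measurable_partIncrement zero_le_one).mono (𝓕.le 1) le_rfl
  have hmap := h.map_partIncrement_of_trim_eq (t := 1) rfl zero_lt_one
  simp only [NNReal.coe_one, NNReal.coe_zero, sub_zero, mul_one] at hmap
  have e : plusPart X 1 = Prod.fst ∘ partIncrement X 0 1 := by
    ext ω
    simp [partIncrement, plusPart_zero]
  rw [e, ← Measure.map_map measurable_fst hD, hmap, Measure.map_fst_prod]
  simp

lemma map_minusPart_one_bilateralEsscher (h : IsAdmissible 𝓕 P X αp ℓp αm ℓm θp θm) :
    (bilateralEsscher P X θp θm 1).map (minusPart X 1) = gammaMeasure αm (ℓm - θm) := by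
  have := isProbabilityMeasure_gammaMeasure h.αp_pos (sub_pos.mpr h.θp_lt)
  have := isProbabilityMeasure_gammaMeasure h.αm_pos (sub_pos.mpr h.θm_lt)
  have hD : Measurable (partIncrement X 0 1) :=
    (h.process.1.measurable_partIncrement zero_le_one).mono (𝓕.le 1) le_rfl
  have hmap := h.map_partIncrement_of_trim_eq (t := 1) rfl zero_lt_one
  simp only [NNReal.coe_one, NNReal.coe_zero, sub_zero, mul_one] at hmap
  have e : minusPart X 1 = Prod.snd ∘ partIncrement X 0 1 := by
    ext ω
    simp [partIncrement, minusPart_zero]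
  rw [e, ← Measure.map_map measurable_snd hD, hmap, Measure.map_snd_prod]
  simp

lemma integrable_exp_plusPart_one (h : IsAdmissible 𝓕 P X αp ℓp αm ℓm θp θm)
    (hθ : 1 < ℓp - θp) :
    Integrable (fun ω => Real.exp (plusPart X 1 ω)) (bilateralEsscher P X θp θm 1) := by
  have hm : Measurable (plusPart X 1) := (h.process.1.measurable_plusPart 1).mono (𝓕.le 1) le_rfl
  refine ⟨by fun_prop, ?_⟩
  rw [hasFiniteIntegral_iff_ofReal (ae_of_all _ fun ω => (Real.exp_pos _).le),
    ← lintegral_map (f := fun x => ENNReal.ofReal (Real.exp x)) (by fun_prop) hm,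
    h.map_plusPart_one_bilateralEsscher]
  have := lintegral_exp_gammaMeasure h.αp_pos (sub_pos.mpr h.θp_lt) hθ
  simp only [one_mul] at this
  rw [this]
  exact ENNReal.ofReal_lt_top

lemma lintegral_discountedPrice_one (h : IsAdmissible 𝓕 P X αp ℓp αm ℓm θp θm) (hS₀ : 0 < S₀) :
    ∫⁻ ω, ENNReal.ofReal (discountedPrice S₀ r q X 1 ω) ∂bilateralEsscher P X θp θm 1 =
      ENNReal.ofReal (S₀ * Real.exp (-(r - q))) *
        ∫⁻ x, ENNReal.ofReal (Real.exp x) ∂bilateralGammaMeasure αp (ℓp - θp) αm (ℓm - θm) := by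
  have hmap := h.map_of_trim_eq (t := 1) rfl one_pos
  simp only [NNReal.coe_one, mul_one] at hmap
  rw [← hmap, lintegral_map (by fun_prop) (h.process.1.measurable 1),
    ← lintegral_const_mul _ (by have := h.process.1.measurable 1; fun_prop)]
  refine lintegral_congr fun ω => ?_
  rw [← ENNReal.ofReal_mul (by positivity), discountedPrice, mul_assoc, ← Real.exp_add]
  simp only [NNReal.coe_one, mul_one]
  ring_nf

/-- Two passages to the limit along the localising sequence: Fatou's lemma yields `1 < ℓp - θp`, and
this makes `e^{X⁺ 1}` an integrable majorant, which upgrades the inequality for the mean of the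
price at time `1` to an equality. -/
lemma martingaleCondition_of_isLocalMartingale (h : IsAdmissible 𝓕 P X αp ℓp αm ℓm θp θm)
    (hS₀ : 0 < S₀) (hqr : q ≤ r)
    (hloc : IsLocalMartingale 𝓕 (bilateralEsscher P X θp θm) (discountedPrice S₀ r q X)) :
    MartingaleCondition (r - q) αp (ℓp - θp) αm (ℓm - θm) := by
  have hprob := h.isLocallyEquivalentProbability.isProbabilityMeasure 1
  obtain ⟨τ, hτ, hmart⟩ := hloc 1
  set μ := bilateralEsscher P X θp θm 1 with hμdef
  have hμP : μ ≪ P := withDensity_absolutelyContinuous P _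
  set S := discountedPrice S₀ r q X with hS
  have hSpos (t : ℝ≥0) (ω : Ω) : 0 < S t ω := mul_pos hS₀ (Real.exp_pos _)
  -- Localisation multiplies by the indicator of `⊥ < τ n`, so the initial value of `Y n` may be `0`
  -- instead of `S₀`; its mean reaches `S₀` only in the limit.
  set Y : ℕ → ℝ≥0 → Ω → ℝ := fun n => stoppedProcess
    (fun i => {ω | ⊥ < τ n ω}.indicator (S (min i 1))) (τ n) with hY
  have hYint (n : ℕ) (t : ℝ≥0) : Integrable (Y n t) μ := (hmart n).integrable t
  have hYnonneg (n : ℕ) (t : ℝ≥0) (ω : Ω) : 0 ≤ Y n t ω :=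
    Set.indicator_nonneg (fun ω _ => (hSpos _ ω).le) ω
  have hcoe (t : ℝ≥0) : (t : WithTop ℝ≥0).untopA = t := rfl
  have hY0 (n : ℕ) (ω : Ω) : Y n 0 ω = {ω | ⊥ < τ n ω}.indicator (S 0) ω := by
    have : min ((0 : ℝ≥0) : WithTop ℝ≥0) (τ n ω) = ((0 : ℝ≥0) : WithTop ℝ≥0) :=
      min_eq_left bot_le
    have h0 : min (0 : ℝ≥0) 1 = 0 := min_eq_left zero_le_one
    simp only [hY, stoppedProcess, this, hcoe, h0]
  have hY1 (n : ℕ) (ω : Ω) (hω : 1 < τ n ω) : Y n 1 ω = S 1 ω := by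
    have h1 : min ((1 : ℝ≥0) : WithTop ℝ≥0) (τ n ω) = ((1 : ℝ≥0) : WithTop ℝ≥0) :=
      min_eq_left hω.le
    have h2 : ⊥ < τ n ω := bot_le.trans_lt hω
    simp only [hY, stoppedProcess, h1, hcoe, min_self]
    exact Set.indicator_of_mem (s := {ω | ⊥ < τ n ω}) h2 _
  have hYle (n : ℕ) (ω : Ω) : ∃ s ≤ (1 : ℝ≥0), Y n 1 ω ≤ S s ω :=
    ⟨_, min_le_right _ _, Set.indicator_le_self' (fun _ _ => (hSpos _ _).le) ω⟩
  have hS0 : ∀ᵐ ω ∂μ, S 0 ω = S₀ := by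
    filter_upwards [hμP h.process.1.zero] with ω hω
    have hω' : X 0 ω = 0 := hω
    simp [hS, discountedPrice, hω']
  have hev : ∀ᵐ ω ∂μ, ∀ᶠ n in atTop, 1 < τ n ω := by
    filter_upwards [hτ.tendsto_top] with ω hω
    exact hω.eventually_const_lt (WithTop.coe_lt_top (1 : ℝ≥0))
  have hlim1 : ∀ᵐ ω ∂μ, Tendsto (fun n => Y n 1 ω) atTop (𝓝 (S 1 ω)) := by
    filter_upwards [hev] with ω hω
    exact tendsto_const_nhds.congr' (hω.mono fun n hn => (hY1 n ω hn).symm)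
  have hEq (n : ℕ) : ∫ ω, Y n 1 ω ∂μ = ∫ ω, Y n 0 ω ∂μ := by
    rw [← integral_condExp (𝓕.le 0)]
    exact integral_congr_ae ((hmart n).2 0 1 zero_le_one)
  have hY0le (n : ℕ) : ∀ᵐ ω ∂μ, ‖Y n 0 ω‖ ≤ S₀ := by
    filter_upwards [hS0] with ω hω
    rw [Real.norm_of_nonneg (hYnonneg n 0 ω), hY0, ← hω]
    exact Set.indicator_le_self' (fun _ _ => (hSpos _ _).le) ω
  have hE0 : Tendsto (fun n => ∫ ω, Y n 0 ω ∂μ) atTop (𝓝 S₀) := by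
    have := tendsto_integral_of_dominated_convergence (μ := μ) (f := fun _ => S₀)
      (F := fun n => Y n 0) (fun _ => S₀) (fun n => (hYint n 0).1) (integrable_const _) hY0le ?_
    · simpa using this
    · filter_upwards [hev, hS0] with ω hω hω0
      refine tendsto_const_nhds.congr' (hω.mono fun n hn => ?_)
      have h2 : ⊥ < τ n ω := bot_le.trans_lt hn
      simp only [hY0]
      rw [Set.indicator_of_mem (s := {ω | ⊥ < τ n ω}) h2, hω0]
  have hfatou : ∫⁻ ω, ENNReal.ofReal (S 1 ω) ∂μ ≤ ENNReal.ofReal S₀ := by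
    have hE0' := (ENNReal.continuous_ofReal.tendsto _).comp hE0
    calc _ = ∫⁻ ω, liminf (fun n => ENNReal.ofReal (Y n 1 ω)) atTop ∂μ := by
          refine lintegral_congr_ae ?_
          filter_upwards [hlim1] with ω hω
          exact (ENNReal.tendsto_ofReal hω).liminf_eq.symm
      _ ≤ liminf (fun n => ∫⁻ ω, ENNReal.ofReal (Y n 1 ω) ∂μ) atTop :=
          lintegral_liminf_le' fun n => (hYint n 1).1.aemeasurable.ennreal_ofReal
      _ = ENNReal.ofReal S₀ := by
          rw [← hE0'.liminf_eq]
          congr 1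
          ext n
          rw [← ofReal_integral_eq_lintegral_ofReal (hYint n 1)
            (ae_of_all _ fun ω => hYnonneg n 1 ω), hEq]
          rfl
  rw [hS, hμdef, h.lintegral_discountedPrice_one hS₀] at hfatou
  have hone : 1 < ℓp - θp := by
    refine one_lt_of_lintegral_exp_bilateralGammaMeasure_lt_top h.αp_pos (sub_pos.mpr h.θp_lt)
      h.αm_pos (sub_pos.mpr h.θm_lt) (lt_top_iff_ne_top.mpr fun htop => ?_)
    rw [htop, ENNReal.mul_top (by simpa using by positivity)] at hfatou
    exact ENNReal.ofReal_ne_top (top_le_iff.mp hfatou)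
  have hdom : ∀ n, ∀ᵐ ω ∂μ, ‖Y n 1 ω‖ ≤ S₀ * Real.exp (plusPart X 1 ω) := fun n => by
    filter_upwards [hμP (h.ae_discountedPrice_le hS₀ hqr 1)] with ω hω
    obtain ⟨s, hs, hle⟩ := hYle n ω
    rw [Real.norm_of_nonneg (hYnonneg n 1 ω)]
    exact hle.trans (hω s hs)
  have hE1 : Tendsto (fun n => ∫ ω, Y n 1 ω ∂μ) atTop (𝓝 (∫ ω, S 1 ω ∂μ)) :=
    tendsto_integral_of_dominated_convergence _ (fun n => (hYint n 1).1)
      ((h.integrable_exp_plusPart_one hone).const_mul S₀) hdom hlim1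
  have hES : ∫ ω, S 1 ω ∂μ = S₀ := tendsto_nhds_unique hE1 (by simpa only [hEq] using hE0)
  have hpos1 : 0 < (ℓp - θp) / (ℓp - θp - 1) := div_pos (by linarith) (by linarith)
  have hpos2 : 0 < (ℓm - θm) / (ℓm - θm + 1) :=
    div_pos (sub_pos.mpr h.θm_lt) (by linarith [h.θm_lt])
  rw [integral_eq_lintegral_of_nonneg_ae (ae_of_all _ fun ω => (hSpos 1 ω).le)
    ((h.process.1.measurable_discountedPrice S₀ r q 1).mono (𝓕.le 1) le_rfl).aestronglyMeasurable,
    hS, hμdef, h.lintegral_discountedPrice_one hS₀,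
    lintegral_exp_one_bilateralGammaMeasure h.αp_pos hone h.αm_pos (sub_pos.mpr h.θm_lt),
    ← ENNReal.ofReal_mul (by positivity), ENNReal.toReal_ofReal (by positivity), mul_assoc,
    mul_eq_left₀ hS₀.ne', Real.exp_neg, inv_mul_eq_one₀ (Real.exp_pos _).ne'] at hES
  exact ⟨hone, hES.symm⟩

/-- The martingale measures among the bilateral Esscher transforms. -/
theorem isLocalMartingale_iff (h : IsAdmissible 𝓕 P X αp ℓp αm ℓm θp θm)
    (hS₀ : 0 < S₀) (hqr : q ≤ r) :
    IsLocalMartingale 𝓕 (bilateralEsscher P X θp θm) (discountedPrice S₀ r q X) ↔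
      MartingaleCondition (r - q) αp (ℓp - θp) αm (ℓm - θm) :=
  ⟨h.martingaleCondition_of_isLocalMartingale hS₀ hqr, h.isLocalMartingale_of_martingaleCondition⟩

end IsAdmissible

end Martingale

/-! ### Relative entropy of the transforms -/

section Entropy

variable {Ω : Type*} {mΩ : MeasurableSpace Ω}

lemma trim_withDensity_of_measurable {m : MeasurableSpace Ω} {μ : @Measure Ω mΩ} (hm : m ≤ mΩ)
    {f : Ω → ℝ≥0∞} (hf : Measurable[m] f) :
    (μ.withDensity f).trim hm = (μ.trim hm).withDensity f := by
  refine @Measure.ext _ m _ _ fun A hA => ?_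
  rw [trim_measurableSet_eq hm hA, withDensity_apply _ (hm A hA), withDensity_apply _ hA,
    restrict_trim hm μ hA, lintegral_trim hm hf]

variable {P : Measure Ω} [IsProbabilityMeasure P] {𝓕 : Filtration ℝ≥0 mΩ} {X : ℝ≥0 → Ω → ℝ}
  {αp ℓp αm ℓm θp θm : ℝ}

namespace IsAdmissible

/-- The log-density is affine in `X⁺ 1` and `X⁻ 1`, whose means under the transform are `α / (ℓ -
θ)`. The function `g` appears through `θ / (ℓ - θ) = ℓ / (ℓ - θ) - 1`. -/
lemma integral_log_esscherLikelihood_one (h : IsAdmissible 𝓕 P X αp ℓp αm ℓm θp θm) :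
    Integrable (fun ω => Real.log (esscherLikelihood P X θp θm 1 ω))
      (bilateralEsscher P X θp θm 1) ∧
    ∫ ω, Real.log (esscherLikelihood P X θp θm 1 ω) ∂bilateralEsscher P X θp θm 1 =
      αp * gFun (ℓp / (ℓp - θp)) + αm * gFun (ℓm / (ℓm - θm)) := by
  have hprob := h.isLocallyEquivalentProbability.isProbabilityMeasure 1
  have hdp : 0 < ℓp - θp := sub_pos.mpr h.θp_lt
  have hdm : 0 < ℓm - θm := sub_pos.mpr h.θm_lt
  have hp : Measurable (plusPart X 1) := (h.process.1.measurable_plusPart 1).mono (𝓕.le 1) le_rfl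
  have hm : Measurable (minusPart X 1) :=
    (h.process.1.measurable_minusPart 1).mono (𝓕.le 1) le_rfl
  have hip : Integrable (plusPart X 1) (bilateralEsscher P X θp θm 1) := by
    have := integrable_id_gammaMeasure h.αp_pos hdp
    rw [← h.map_plusPart_one_bilateralEsscher] at this
    exact this.comp_measurable hp
  have him : Integrable (minusPart X 1) (bilateralEsscher P X θp θm 1) := by
    have := integrable_id_gammaMeasure h.αm_pos hdm
    rw [← h.map_minusPart_one_bilateralEsscher] at this
    exact this.comp_measurable hm
  have hep : ∫ ω, plusPart X 1 ω ∂bilateralEsscher P X θp θm 1 = αp / (ℓp - θp) := by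
    rw [← integral_id_gammaMeasure h.αp_pos hdp, ← h.map_plusPart_one_bilateralEsscher,
      integral_map hp.aemeasurable (by fun_prop)]
  have hem : ∫ ω, minusPart X 1 ω ∂bilateralEsscher P X θp θm 1 = αm / (ℓm - θm) := by
    rw [← integral_id_gammaMeasure h.αm_pos hdm, ← h.map_minusPart_one_bilateralEsscher,
      integral_map hm.aemeasurable (by fun_prop)]
  have hlog : (fun ω => Real.log (esscherLikelihood P X θp θm 1 ω)) = fun ω =>
      (θp * plusPart X 1 ω - αp * Real.log (ℓp / (ℓp - θp))) +
        (θm * minusPart X 1 ω - αm * Real.log (ℓm / (ℓm - θm))) := by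
    ext ω
    rw [h.esscherLikelihood_eq, ← Real.exp_add, Real.log_exp]
    simp
  have i1 : Integrable (fun ω => θp * plusPart X 1 ω - αp * Real.log (ℓp / (ℓp - θp)))
      (bilateralEsscher P X θp θm 1) := (hip.const_mul θp).sub (integrable_const _)
  have i2 : Integrable (fun ω => θm * minusPart X 1 ω - αm * Real.log (ℓm / (ℓm - θm)))
      (bilateralEsscher P X θp θm 1) := (him.const_mul θm).sub (integrable_const _)
  rw [hlog]
  refine ⟨i1.add i2, ?_⟩
  rw [integral_add i1 i2, integral_sub (hip.const_mul θp) (integrable_const _),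
    integral_sub (him.const_mul θm) (integrable_const _), integral_const_mul θp,
    integral_const_mul θm, hep, hem]
  simp only [integral_const, probReal_univ, one_smul, gFun]
  field_simp
  ring

/-- The relative entropy of the bilateral Esscher transforms. -/
theorem relativeEntropy_of_trim_eq (h : IsAdmissible 𝓕 P X αp ℓp αm ℓm θp θm)
    {Q : ℝ≥0 → Measure Ω}
    (hQ : (Q 1).trim (𝓕.le 1) = (bilateralEsscher P X θp θm 1).trim (𝓕.le 1)) :
    relativeEntropy 𝓕 P Q =
      ENNReal.ofReal (αp * gFun (ℓp / (ℓp - θp)) + αm * gFun (ℓm / (ℓm - θm))) := by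
  have hprob := h.isLocallyEquivalentProbability.isProbabilityMeasure 1
  have hac := h.isLocallyEquivalentProbability.absolutelyContinuous 1
  have hmeas := h.process.1.measurable_esscherLikelihood P θp θm 1
  have hd : (bilateralEsscher P X θp θm 1).trim (𝓕.le 1) = (P.trim (𝓕.le 1)).withDensity
      (fun ω => ENNReal.ofReal (esscherLikelihood P X θp θm 1 ω)) :=
    trim_withDensity_of_measurable (𝓕.le 1) hmeas.ennreal_ofReal
  have hllr : llr ((bilateralEsscher P X θp θm 1).trim (𝓕.le 1)) (P.trim (𝓕.le 1))
      =ᵐ[(bilateralEsscher P X θp θm 1).trim (𝓕.le 1)]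
      fun ω => Real.log (esscherLikelihood P X θp θm 1 ω) := by
    refine hac.ae_le ?_
    have := Measure.rnDeriv_withDensity (P.trim (𝓕.le 1)) hmeas.ennreal_ofReal
    rw [← hd] at this
    filter_upwards [this] with ω hω
    rw [llr, hω, ENNReal.toReal_ofReal (esscherLikelihood_pos P X θp θm 1 ω).le]
  obtain ⟨hint, hval⟩ := h.integral_log_esscherLikelihood_one
  have hlm : Measurable[𝓕 1] fun ω => Real.log (esscherLikelihood P X θp θm 1 ω) := hmeas.log
  -- The formula for `klDiv` also contains the difference of the total masses, which cancels for
  -- probability measures.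
  rw [relativeEntropy, hQ, InformationTheory.klDiv_of_ac_of_integrable hac
    ((integrable_congr hllr).mpr (hint.trim (𝓕.le 1) hlm.stronglyMeasurable)),
    integral_congr_ae hllr, ← integral_trim (𝓕.le 1) hlm.stronglyMeasurable, hval,
    measureReal_def, measureReal_def, trim_measurableSet_eq _ .univ, trim_measurableSet_eq _ .univ,
    measure_univ, measure_univ, add_sub_cancel_right]

end IsAdmissible

end Entropy

/-! ### The martingale condition as the graph of `Phi` -/

section ParameterCurve

variable {r q αp ℓp αm ℓm θp θm : ℝ}

/-- The product form also covers `r = q`, where the bracket vanishes and the left end point is `-∞`.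
-/
lemma mul_one_sub_exp_lt_one_iff (hqr : q ≤ r) (hαp : 0 < αp) (θ : ℝ) :
    (ℓp - θ) * (1 - Real.exp (-(r - q) / αp)) < 1 ↔
      (q < r → ℓp - (1 - Real.exp (-(r - q) / αp))⁻¹ < θ) := by
  rcases hqr.eq_or_lt with rfl | hlt
  · simp
  have hd : 0 < 1 - Real.exp (-(r - q) / αp) := by
    rw [sub_pos, Real.exp_lt_one_iff]
    exact div_neg_of_neg_of_pos (by linarith) hαp
  rw [← lt_div_iff₀ hd, one_div]
  constructor
  · intro h _
    linarith
  · intro h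
    linarith [h hlt]

lemma one_lt_rpow_mul_exp_iff {w c : ℝ} (hw : 1 < w) (hαp : 0 < αp) :
    1 < (w / (w - 1)) ^ αp * Real.exp (-c) ↔ w * (1 - Real.exp (-c / αp)) < 1 := by
  have hw1 : 0 < w - 1 := sub_pos.mpr hw
  have hpos : 0 < w / (w - 1) := div_pos (by linarith) hw1
  have h1 : (w / (w - 1)) ^ αp * Real.exp (-c) = (w / (w - 1) * Real.exp (-c / αp)) ^ αp := by
    rw [Real.mul_rpow hpos.le (Real.exp_pos _).le, ← Real.exp_mul, div_mul_cancel₀ _ hαp.ne']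
  have h2 := Real.rpow_lt_rpow_iff zero_le_one (mul_pos hpos (Real.exp_pos (-c / αp))).le hαp
  rw [Real.one_rpow] at h2
  rw [h1, h2, div_mul_eq_mul_div, lt_div_iff₀ hw1]
  constructor <;> intro h <;> linarith

/-- Solving for `y`: the reciprocal of `y / (y + 1)` is `1 + y⁻¹`. -/
lemma rpow_mul_rpow_eq_exp_iff {w y c : ℝ} (hw : 1 < w) (hy : 0 < y) (hαm : 0 < αm) :
    (w / (w - 1)) ^ αp * (y / (y + 1)) ^ αm = Real.exp c ↔
      ((w / (w - 1)) ^ αp * Real.exp (-c)) ^ (1 / αm) - 1 = y⁻¹ := by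
  have hpos : 0 < w / (w - 1) := div_pos (by linarith) (sub_pos.mpr hw)
  set A := (w / (w - 1)) ^ αp with hA
  have hApos : 0 < A := Real.rpow_pos_of_pos hpos _
  have hy1 : y⁻¹ + 1 = (y / (y + 1))⁻¹ := by
    field_simp
    ring
  have hB : 0 < (y / (y + 1)) ^ αm := by positivity
  rw [sub_eq_iff_eq_add, hy1, one_div,
    Real.rpow_inv_eq (by positivity) (by positivity) hαm.ne', Real.inv_rpow (by positivity),
    Real.exp_neg]
  have he := Real.exp_pos c
  constructor
  · intro h
    rw [← h]
    field_simp
  · intro h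
    field_simp at h
    exact h

/-- The pairs of parameters that satisfy the martingale condition form the graph of `Phi`. -/
lemma martingaleCondition_iff (hqr : q ≤ r) (hαp : 0 < αp) (hαm : 0 < αm) (hθm : θm < ℓm) :
    MartingaleCondition (r - q) αp (ℓp - θp) αm (ℓm - θm) ↔
      θp ∈ parameterInterval r q αp ℓp ∧ θm = Phi r q αp ℓp αm ℓm θp := by
  have hy : 0 < ℓm - θm := sub_pos.mpr hθm
  constructor
  · rintro ⟨hw, h⟩
    have h' := (rpow_mul_rpow_eq_exp_iff hw hy hαm).mp h
    have hA : 0 < ((ℓp - θp) / (ℓp - θp - 1)) ^ αp * Real.exp (-(r - q)) := by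
      have : 0 < (ℓp - θp) / (ℓp - θp - 1) := div_pos (by linarith) (by linarith)
      positivity
    have h1 : 1 < ((ℓp - θp) / (ℓp - θp - 1)) ^ αp * Real.exp (-(r - q)) := by
      have := inv_pos.mpr hy
      -- As `y⁻¹ > 0`, the power exceeds `1` and so does its base. This is the lower end point of
      -- the interval.
      by_contra! hle
      have := Real.rpow_le_one hA.le hle (by positivity : 0 ≤ 1 / αm)
      linarith
    refine ⟨⟨(mul_one_sub_exp_lt_one_iff hqr hαp θp).mp ((one_lt_rpow_mul_exp_iff hw hαp).mp h1),
      by linarith⟩, ?_⟩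
    rw [Phi, h', inv_inv]
    ring
  · rintro ⟨⟨h1, h2⟩, h3⟩
    have hw : 1 < ℓp - θp := by linarith
    refine ⟨hw, (rpow_mul_rpow_eq_exp_iff hw hy hαm).mpr ?_⟩
    rw [h3, Phi, sub_sub_cancel, inv_inv]

lemma Phi_lt (hqr : q ≤ r) (hαp : 0 < αp) (hαm : 0 < αm)
    (hθ : θp ∈ parameterInterval r q αp ℓp) : Phi r q αp ℓp αm ℓm θp < ℓm := by
  have hw : 1 < ℓp - θp := by linarith [hθ.2]
  have h1 := (one_lt_rpow_mul_exp_iff hw hαp).mpr ((mul_one_sub_exp_lt_one_iff hqr hαp θp).mpr hθ.1)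
  have h2 := Real.one_lt_rpow h1 (by positivity : 0 < 1 / αm)
  rw [Phi, sub_lt_self_iff, inv_pos, sub_pos]
  exact h2

lemma exists_mem_parameterInterval (hqr : q ≤ r) (hαp : 0 < αp) :
    ∃ θ, θ ∈ parameterInterval r q αp ℓp := by
  set e := Real.exp (-(r - q) / αp) with he
  have hpos : 0 < e := Real.exp_pos _
  have hle : e ≤ 1 := Real.exp_le_one_iff.mpr (div_nonpos_of_nonpos_of_nonneg (by linarith) hαp.le)
  -- This is the rate `w = 1 + e / 2`, for which `w * (1 - e) = 1 - e / 2 - e ^ 2 / 2 < 1`.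
  refine ⟨ℓp - 1 - e / 2, (mul_one_sub_exp_lt_one_iff hqr hαp _).mp ?_, by linarith⟩
  rw [← he]
  nlinarith

end ParameterCurve

/-! ### Existence of a minimiser by compactness -/

section Minimizer

lemma gFun_nonneg {x : ℝ} (hx : 0 < x) : 0 ≤ gFun x := by
  have := Real.log_le_sub_one_of_pos hx
  unfold gFun
  linarith

lemma exp_le_of_gFun_le {x a : ℝ} (hx : 0 < x) (h : gFun x ≤ a) : Real.exp (-1 - a) ≤ x := by
  rw [← Real.le_log_iff_exp_le hx]
  unfold gFun at h
  linarith

/-- The tangent of the logarithm at `2` gives `g(x) ≥ x / 2 - log 2`. -/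
lemma le_of_gFun_le {x a : ℝ} (hx : 0 < x) (h : gFun x ≤ a) : x ≤ 2 * (a + 1) := by
  have h1 := Real.log_le_sub_one_of_pos (half_pos hx)
  rw [Real.log_div hx.ne' two_ne_zero] at h1
  have h2 := Real.log_two_lt_d9
  unfold gFun at h
  linarith

/-- The relative entropy as a function of the rates `w`, `y` of the transformed process. -/
noncomputable def rateEntropy (αp ℓp αm ℓm : ℝ) (z : ℝ × ℝ) : ℝ :=
  αp * gFun (ℓp / z.1) + αm * gFun (ℓm / z.2)

/-- Both summands of the entropy are nonnegative, so a competitor `z₀` bounds each of them. The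
bounds on `g` then confine all better points to a compact rectangle. -/
lemma exists_isMinOn_rateEntropy {c αp ℓp αm ℓm : ℝ} (hαp : 0 < αp) (hℓp : 0 < ℓp)
    (hαm : 0 < αm) (hℓm : 0 < ℓm)
    (hne : ∃ z : ℝ × ℝ, 0 < z.2 ∧ MartingaleCondition c αp z.1 αm z.2) :
    ∃ z : ℝ × ℝ, (0 < z.2 ∧ MartingaleCondition c αp z.1 αm z.2) ∧
      ∀ z' : ℝ × ℝ, 0 < z'.2 → MartingaleCondition c αp z'.1 αm z'.2 →
        rateEntropy αp ℓp αm ℓm z ≤ rateEntropy αp ℓp αm ℓm z' := by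
  obtain ⟨z₀, hz₀, hC₀⟩ := hne
  set E := rateEntropy αp ℓp αm ℓm with hE
  set a := E z₀ / αp
  set b := E z₀ / αm
  -- The reciprocal of the moment. Unlike the moment itself, it extends continuously to the edge
  -- `z.1 = 1`, which the closed rectangle `R` contains.
  set G : ℝ × ℝ → ℝ := fun z => (1 - z.1⁻¹) ^ αp * (1 + z.2⁻¹) ^ αm with hG
  have hGiff (z : ℝ × ℝ) (hz1 : 1 < z.1) (hz2 : 0 < z.2) :
      (z.1 / (z.1 - 1)) ^ αp * (z.2 / (z.2 + 1)) ^ αm = Real.exp c ↔ G z = Real.exp (-c) := by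
    have h1 : 0 < z.1 / (z.1 - 1) := div_pos (by linarith) (by linarith)
    have h2 : 0 < z.2 / (z.2 + 1) := by positivity
    have e1 : 1 - z.1⁻¹ = (z.1 / (z.1 - 1))⁻¹ := by
      have : z.1 ≠ 0 := by linarith
      field_simp
    have e2 : 1 + z.2⁻¹ = (z.2 / (z.2 + 1))⁻¹ := by field_simp
    simp only [hG]
    rw [e1, e2, Real.inv_rpow h1.le, Real.inv_rpow h2.le, ← mul_inv, Real.exp_neg, inv_inj]
  set R : Set (ℝ × ℝ) := Set.Icc 1 (ℓp / Real.exp (-1 - a)) ×ˢ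
    Set.Icc (ℓm / (2 * (b + 1))) (ℓm / Real.exp (-1 - b)) with hR
  have hEpos (z : ℝ × ℝ) (hz1 : 0 < z.1) (hz2 : 0 < z.2) :
      0 ≤ αp * gFun (ℓp / z.1) ∧ 0 ≤ αm * gFun (ℓm / z.2) :=
    ⟨mul_nonneg hαp.le (gFun_nonneg (div_pos hℓp hz1)),
      mul_nonneg hαm.le (gFun_nonneg (div_pos hℓm hz2))⟩
  have hb : 0 ≤ b := by
    obtain ⟨h1, h2⟩ := hEpos z₀ (by linarith [hC₀.1]) hz₀
    exact div_nonneg (add_nonneg h1 h2) hαm.le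
  have hRpos (z : ℝ × ℝ) (hz : z ∈ R) : 1 ≤ z.1 ∧ 0 < z.2 :=
    ⟨hz.1.1, lt_of_lt_of_le (by positivity) hz.2.1⟩
  have hmem (z : ℝ × ℝ) (hz1 : 1 < z.1) (hz2 : 0 < z.2) (hz : E z ≤ E z₀) : z ∈ R := by
    have hz1' : 0 < z.1 := by linarith
    obtain ⟨h1, h2⟩ := hEpos z hz1' hz2
    have hsum : αp * gFun (ℓp / z.1) + αm * gFun (ℓm / z.2) ≤ E z₀ := hz
    have ha' : gFun (ℓp / z.1) ≤ a := by
      rw [le_div_iff₀ hαp]; linarith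
    have hb' : gFun (ℓm / z.2) ≤ b := by
      rw [le_div_iff₀ hαm]; linarith
    refine ⟨⟨hz1.le, ?_⟩, ?_, ?_⟩
    · have := exp_le_of_gFun_le (div_pos hℓp hz1') ha'
      rwa [le_div_comm₀ (Real.exp_pos _) hz1'] at this
    · have := le_of_gFun_le (div_pos hℓm hz2) hb'
      rwa [div_le_comm₀ hz2 (by positivity)] at this
    · have := exp_le_of_gFun_le (div_pos hℓm hz2) hb'
      rwa [le_div_comm₀ (Real.exp_pos _) hz2] at this
  have hGcont : ContinuousOn G R := by
    have c1 : ContinuousOn (fun z : ℝ × ℝ => z.1⁻¹) R :=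
      continuousOn_fst.inv₀ fun z hz => by linarith [(hRpos z hz).1]
    have c2 : ContinuousOn (fun z : ℝ × ℝ => z.2⁻¹) R :=
      continuousOn_snd.inv₀ fun z hz => (hRpos z hz).2.ne'
    exact ((continuousOn_const.sub c1).rpow_const fun z _ => Or.inr hαp.le).mul
      ((continuousOn_const.add c2).rpow_const fun z _ => Or.inr hαm.le)
  have hEcont : ContinuousOn E R := by
    have c1 : ContinuousOn (fun z : ℝ × ℝ => ℓp / z.1) R :=
      continuousOn_const.div continuousOn_fst fun z hz => by linarith [(hRpos z hz).1]
    have c2 : ContinuousOn (fun z : ℝ × ℝ => ℓm / z.2) R :=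
      continuousOn_const.div continuousOn_snd fun z hz => (hRpos z hz).2.ne'
    have l1 := c1.log fun z hz => (div_pos hℓp (by linarith [(hRpos z hz).1])).ne'
    have l2 := c2.log fun z hz => (div_pos hℓm (hRpos z hz).2).ne'
    exact (continuousOn_const.mul ((c1.sub continuousOn_const).sub l1)).add
      (continuousOn_const.mul ((c2.sub continuousOn_const).sub l2))
  have hRcomp : IsCompact R := isCompact_Icc.prod isCompact_Icc
  set K : Set (ℝ × ℝ) := R ∩ G ⁻¹' {Real.exp (-c)} with hK
  have hKcomp : IsCompact K := hRcomp.of_isClosed_subset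
    (hGcont.preimage_isClosed_of_isClosed hRcomp.isClosed isClosed_singleton) Set.inter_subset_left
  have hz₀K : z₀ ∈ K := ⟨hmem z₀ hC₀.1 hz₀ le_rfl, (hGiff z₀ hC₀.1 hz₀).mp hC₀.2⟩
  obtain ⟨z, hzK, hmin⟩ := hKcomp.exists_isMinOn ⟨z₀, hz₀K⟩ (hEcont.mono Set.inter_subset_left)
  obtain ⟨hz1, hz2⟩ := hRpos z hzK.1
  have hzG : G z = Real.exp (-c) := hzK.2
  have hz1' : 1 < z.1 := by
    -- The edge is excluded because `G` vanishes there, whereas the constraint value is positive.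
    refine lt_of_le_of_ne hz1 fun heq => ?_
    have : G z = 0 := by simp [hG, ← heq, Real.zero_rpow hαp.ne']
    exact (Real.exp_pos (-c)).ne' (hzG ▸ this)
  refine ⟨z, ⟨hz2, hz1', (hGiff z hz1' hz2).mpr hzG⟩, fun z' hz' hC' => ?_⟩
  rcases le_or_gt (E z') (E z₀) with hle | hlt
  · exact hmin ⟨hmem z' hC'.1 hz' hle, (hGiff z' hC'.1 hz').mp hC'.2⟩
  · exact (hmin hz₀K).trans hlt.le

end Minimizer

end BilateralGamma

/-! ### The main theorem -/

theorem mainTheorem3 {Ω : Type*} [mΩ : MeasurableSpace Ω] (P : Measure Ω) [IsProbabilityMeasure P]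
    (𝓕 : Filtration ℝ≥0 mΩ) (X : ℝ≥0 → Ω → ℝ) (S₀ r q αp ℓp αm ℓm : ℝ)
    (hS₀ : 0 < S₀) (hq : 0 ≤ q) (hqr : q ≤ r)
    (hαp : 0 < αp) (hℓp : 0 < ℓp) (hαm : 0 < αm) (hℓm : 0 < ℓm)
    (hX : BilateralGamma.IsBilateralGammaProcess 𝓕 (fun _ => P) X αp ℓp αm ℓm) :
    -- `X = X⁺ - X⁻` with independent Gamma processes `X⁺`, `X⁻`
    ((∀ᵐ ω ∂P, ∀ t,
        X t ω = BilateralGamma.plusPart X t ω - BilateralGamma.minusPart X t ω) ∧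
      ∀ s t, s < t →
        Indep (𝓕 s) (MeasurableSpace.comap (fun ω =>
          (BilateralGamma.plusPart X t ω - BilateralGamma.plusPart X s ω,
            BilateralGamma.minusPart X t ω - BilateralGamma.minusPart X s ω)) inferInstance) P ∧
        P.map (fun ω =>
          (BilateralGamma.plusPart X t ω - BilateralGamma.plusPart X s ω,
            BilateralGamma.minusPart X t ω - BilateralGamma.minusPart X s ω)) =
          (gammaMeasure (αp * ((t : ℝ) - s)) ℓp).prod (gammaMeasure (αm * ((t : ℝ) - s)) ℓm)) ∧
    -- all bilateral Esscher transforms exist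
    (∀ θp θm : ℝ, θp < ℓp → θm < ℓm →
      BilateralGamma.IsLocallyEquivalentProbability 𝓕 P
        (BilateralGamma.bilateralEsscher P X θp θm)) ∧
    -- a minimizer of the relative entropy exists
    (∃ θ ∈ BilateralGamma.martingaleParameters 𝓕 P X S₀ r q ℓp ℓm,
      IsMinOn (fun ϑ : ℝ × ℝ => BilateralGamma.relativeEntropy 𝓕 P
          (BilateralGamma.bilateralEsscher P X ϑ.1 ϑ.2))
        (BilateralGamma.martingaleParameters 𝓕 P X S₀ r q ℓp ℓm) θ) ∧
    -- properties of every minimizer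
    (∀ θp θm : ℝ, (θp, θm) ∈ BilateralGamma.martingaleParameters 𝓕 P X S₀ r q ℓp ℓm →
      IsMinOn (fun ϑ : ℝ × ℝ => BilateralGamma.relativeEntropy 𝓕 P
          (BilateralGamma.bilateralEsscher P X ϑ.1 ϑ.2))
        (BilateralGamma.martingaleParameters 𝓕 P X S₀ r q ℓp ℓm) (θp, θm) →
      θp ∈ BilateralGamma.parameterInterval r q αp ℓp ∧
      θm = BilateralGamma.Phi r q αp ℓp αm ℓm θp ∧
      IsMinOn (BilateralGamma.entropyFun r q αp ℓp αm ℓm)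
        (BilateralGamma.parameterInterval r q αp ℓp) θp ∧
      BilateralGamma.IsBilateralGammaProcess 𝓕 (BilateralGamma.bilateralEsscher P X θp θm) X
        αp (ℓp - θp) αm (ℓm - θm) ∧
      BilateralGamma.relativeEntropy 𝓕 P (BilateralGamma.bilateralEsscher P X θp θm) =
        ENNReal.ofReal (BilateralGamma.entropyFun r q αp ℓp αm ℓm θp) ∧
      -- the same for a measure on the whole of `Ω` with the same restrictions, if there is one
      ∀ Q : Measure Ω, IsProbabilityMeasure Q →
        (∀ t, Q.trim (𝓕.le t) =
          (BilateralGamma.bilateralEsscher P X θp θm t).trim (𝓕.le t)) →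
        Martingale (BilateralGamma.discountedPrice S₀ r q X) 𝓕 Q ∧
        BilateralGamma.IsBilateralGammaProcess 𝓕 (fun _ => Q) X αp (ℓp - θp) αm (ℓm - θm) ∧
        BilateralGamma.relativeEntropy 𝓕 P (fun _ => Q) =
          ENNReal.ofReal (BilateralGamma.entropyFun r q αp ℓp αm ℓm θp)) := by
  have hadm {θp θm : ℝ} (hp : θp < ℓp) (hm : θm < ℓm) :
      BilateralGamma.IsAdmissible 𝓕 P X αp ℓp αm ℓm θp θm := ⟨hX, hαp, hℓp, hαm, hℓm, hp, hm⟩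
  have hmem (θ : ℝ × ℝ) : θ ∈ BilateralGamma.martingaleParameters 𝓕 P X S₀ r q ℓp ℓm ↔
      θ.1 < ℓp ∧ θ.2 < ℓm ∧
        BilateralGamma.MartingaleCondition (r - q) αp (ℓp - θ.1) αm (ℓm - θ.2) :=
    and_congr_right fun h1 => and_congr_right fun h2 =>
      (hadm h1 h2).isLocalMartingale_iff hS₀ hqr
  have hent {θp θm : ℝ} (h1 : θp < ℓp) (h2 : θm < ℓm) :
      BilateralGamma.relativeEntropy 𝓕 P (BilateralGamma.bilateralEsscher P X θp θm) =
        ENNReal.ofReal (BilateralGamma.rateEntropy αp ℓp αm ℓm (ℓp - θp, ℓm - θm)) :=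
    (hadm h1 h2).relativeEntropy_of_trim_eq rfl
  have hPhi {θ : ℝ} (hθ : θ ∈ BilateralGamma.parameterInterval r q αp ℓp) :
      (θ, BilateralGamma.Phi r q αp ℓp αm ℓm θ) ∈
        BilateralGamma.martingaleParameters 𝓕 P X S₀ r q ℓp ℓm := by
    have h2 := BilateralGamma.Phi_lt (ℓm := ℓm) hqr hαp hαm hθ
    exact (hmem _).mpr ⟨by linarith [hθ.2], h2,
      (BilateralGamma.martingaleCondition_iff hqr hαp hαm h2).mpr ⟨hθ, rfl⟩⟩
  refine ⟨⟨hX.ae_eq_plusPart_sub_minusPart hαp hℓp hαm hℓm, fun s t hst =>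
      ⟨hX.indep_partIncrement hαp hℓp hαm hℓm hst, hX.map_partIncrement hαp hℓp hαm hℓm hst⟩⟩,
    fun θp θm hp hm => (hadm hp hm).isLocallyEquivalentProbability, ?_, ?_⟩
  · obtain ⟨θ₀, hθ₀⟩ := BilateralGamma.exists_mem_parameterInterval (ℓp := ℓp) hqr hαp
    have h₀ := (hmem _).mp (hPhi hθ₀)
    -- The minimisation is carried out in the transformed rates `z = (ℓp - θp, ℓm - θm)`.
    obtain ⟨z, ⟨hz, hC⟩, hmin⟩ := BilateralGamma.exists_isMinOn_rateEntropy
      (c := r - q) hαp hℓp hαm hℓm ⟨(_, _), sub_pos.mpr h₀.2.1, h₀.2.2⟩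
    have h1 : ℓp - z.1 < ℓp := by linarith [hC.1]
    have h2 : ℓm - z.2 < ℓm := by linarith
    refine ⟨(ℓp - z.1, ℓm - z.2), (hmem _).mpr ⟨h1, h2, by simpa using hC⟩, fun ϑ hϑ => ?_⟩
    obtain ⟨h3, h4, hC'⟩ := (hmem ϑ).mp hϑ
    have hle := hmin (ℓp - ϑ.1, ℓm - ϑ.2) (sub_pos.mpr h4) hC'
    simp only [Set.mem_ofPred_eq]
    rw [hent h1 h2, hent h3 h4]
    refine ENNReal.ofReal_le_ofReal ?_
    simpa using hle
  · intro θp θm hθ hmin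
    obtain ⟨h1, h2, hC⟩ := (hmem _).mp hθ
    simp only at h1 h2 hC
    obtain ⟨hI, rfl⟩ := (BilateralGamma.martingaleCondition_iff hqr hαp hαm h2).mp hC
    have h := hadm h1 h2
    refine ⟨hI, rfl, fun θ hθI => ?_, h.isBilateralGammaProcess_of_trim_eq fun t => rfl,
      h.relativeEntropy_of_trim_eq rfl, fun Q _ hQ => ⟨h.martingale_discountedPrice hQ hC,
        h.isBilateralGammaProcess_of_trim_eq hQ, h.relativeEntropy_of_trim_eq (hQ 1)⟩⟩
    -- Every point of the interval yields the competitor `(θ, Phi θ)`. Since the entropy there is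
    -- nonnegative, the inequality in `[0, ∞]` descends to the reals.
    have hle := hmin (hPhi hθI)
    obtain ⟨h3, h4, -⟩ := (hmem _).mp (hPhi hθI)
    simp only [Set.mem_ofPred_eq] at hle
    rw [hent h1 h2, hent h3 h4] at hle
    refine (ENNReal.ofReal_le_ofReal_iff (add_nonneg ?_ ?_)).mp hle
    · exact mul_nonneg hαp.le (BilateralGamma.gFun_nonneg (div_pos hℓp (sub_pos.mpr h3)))
    · exact mul_nonneg hαm.le (BilateralGamma.gFun_nonneg (div_pos hℓm (sub_pos.mpr h4)))
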